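/- Let $\Delta\subset\mathbb R^n$ be a reflexive lattice polytope of dimension $n$ (each facet $F$ of $\Delta$ lies on a hyperplane $\langle m,v_F\rangle=-1$, where $v_F\in\mathbb Z^n$ is the primitive inward conormal vector of $F$), and let $X$ be the complex projective toric variety determined by $\Delta$, with anticanonical divisor $-K_X=\sum_F D_F$. Let $Y\subset X$ be an anticanonical hypersurface, that is, the zero scheme of a nonzero section of $\mathcal O_X(-K_X)$ (in particular, $Y$ may be a generic member of $|-K_X|$), and let $\mathcal L$ be the restriction to $Y$ of the invertible sheaf $\mathcal O_X(-(n-1)K_X)$. Let $D^b(Y)$ be the bounded derived category of coherent sheaves on $Y$, and for integers $r,s$ let $D^{\le s}\cap D^{\ge r}$ be the class of its objects $\mathcal F$ with $H^j(\mathcal F)=0$ for $j\notin[r,s]$. For $p\in\mathbb Z$ put $\mathcal Ext^p(\mathcal A,\mathcal F)=H^p(R\mathcal Hom(\mathcal A,\mathcal F))$, where $R\mathcal Hom$ is the derived functor of the sheaf $\mathcal Hom$. Let $\mathcal F\in D^b(Y)$ lie in $D^{\le s}\cap D^{\ge r}$ and let $b,p,q\in\mathbb Z$. If $$H^q\big(Y,\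 \mathcal Ext^p(\mathcal L^{\otimes b},\mathcal F)\big)\neq 0,$$ then $(p,q)\in[r,s]\times[0,n-1]$. -/

import Mathlib

open CategoryTheory Limits AlgebraicGeometry TopologicalSpace Opposite

namespace BraneVertex
universe u
noncomputable section

section Injectives

instance presheafOfModules_ab5 {C : Type u} [SmallCategory C] (R : Cᵒᵖ ⥤ RingCat.{u}) :
    AB5OfSize.{u, u} (PresheafOfModules.{u} R) where
  ofShape K _ _ :=
    haveI : PreservesFiniteLimits (PresheafOfModules.toPresheaf.{u} R) := inferInstance
    haveI : ReflectsFiniteLimits (PresheafOfModules.toPresheaf.{u} R) :=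
      ⟨fun _ _ _ => inferInstance⟩
    HasExactColimitsOfShape.domain_of_functor K (PresheafOfModules.toPresheaf.{u} R)

variable (X : Scheme.{u})

theorem modules_ab5 : AB5OfSize.{u, u} (SheafOfModules.{u} X.ringCatSheaf) where
  ofShape K _ _ :=
    haveI := (presheafOfModules_ab5 X.ringCatSheaf.obj).ofShape K
    (PresheafOfModules.sheafificationAdjunction (𝟙 X.ringCatSheaf.obj)).hasExactColimitsOfShape K

theorem modules_hasSeparator : HasSeparator (SheafOfModules.{u} X.ringCatSheaf) := by
  let adj := PresheafOfModules.sheafificationAdjunction (𝟙 X.ringCatSheaf.obj)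
  let G : X.Opens → SheafOfModules.{u} X.ringCatSheaf := fun U =>
    (PresheafOfModules.sheafification (𝟙 X.ringCatSheaf.obj)).obj
      ((PresheafOfModules.free X.ringCatSheaf.obj).obj (yoneda.obj U))
  refine ⟨∐ G, ObjectProperty.IsSeparating.isSeparator_coproduct ?_⟩
  intro M N f g h
  apply (SheafOfModules.forget X.ringCatSheaf ⋙
    PresheafOfModules.restrictScalars (𝟙 X.ringCatSheaf.obj)).map_injective
  refine PresheafOfModules.freeYoneda.isSeparating _ _ _ ?_
  rintro _ ⟨U⟩ k
  have := h (G U) ⟨U⟩ ((adj.homEquiv _ _).symm k)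
  have h2 := congrArg (adj.homEquiv _ _) this
  rw [adj.homEquiv_naturality_right, adj.homEquiv_naturality_right, Equiv.apply_symm_apply] at h2
  exact h2

theorem sheafOfModules_isGrothendieckAbelian :
    IsGrothendieckAbelian.{u} (SheafOfModules.{u} X.ringCatSheaf) :=
  haveI := modules_ab5 X
  haveI := modules_hasSeparator X
  { }

instance modules_isGrothendieckAbelian : IsGrothendieckAbelian.{u} X.Modules :=
  sheafOfModules_isGrothendieckAbelian X

end Injectives

section InternalHom
variable {X : Scheme.{u}} (M N : X.Modules)

/-- The group `Hom(M|_U, N|_U)`: families of `𝒪_X(V)`-linear maps `M(V) → N(V)`, for `V ≤ U`,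
that commute with restriction. -/
def homSections (U : X.Opens) :
    AddSubgroup (∀ V : {V : X.Opens // V ≤ U}, Γ(M, V.1) →ₗ[Γ(X, V.1)] Γ(N, V.1)) where
  carrier := {φ | ∀ (V W : {V : X.Opens // V ≤ U}) (h : W.1 ≤ V.1) (m : Γ(M, V.1)),
    N.presheaf.map (homOfLE h).op (φ V m) = φ W (M.presheaf.map (homOfLE h).op m)}
  zero_mem' := fun V W h m => by simp
  add_mem' := fun {a b} ha hb V W h m => by
    simp only [Pi.add_apply, LinearMap.add_apply, map_add, ha V W h m, hb V W h m]
  neg_mem' := fun {a} ha V W h m => by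
    simp only [Pi.neg_apply, LinearMap.neg_apply, map_neg, ha V W h m]

variable {M N}

/-- Multiplication of a local homomorphism over `U` by a function on `U`. -/
instance homSectionsSMul (U : X.Opens) : SMul Γ(X, U) (homSections M N U) where
  smul r φ := ⟨fun V => X.presheaf.map (homOfLE V.2).op r • φ.1 V, fun V W h m => by
    have : X.presheaf.map (homOfLE h).op (X.presheaf.map (homOfLE V.2).op r) =
        X.presheaf.map (homOfLE W.2).op r := by
      rw [← CategoryTheory.comp_apply, ← Functor.map_comp]; rfl
    simp only [LinearMap.smul_apply]
    rw [Scheme.Modules.map_smul, this, φ.2 V W h m]⟩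

theorem homSections_smul_val {U : X.Opens} (r : Γ(X, U)) (φ : homSections M N U)
    (V : {V : X.Opens // V ≤ U}) :
    (r • φ).1 V = X.presheaf.map (homOfLE V.2).op r • φ.1 V := rfl

instance homSectionsModule (U : X.Opens) : Module Γ(X, U) (homSections M N U) where
  one_smul φ := by
    ext V m
    rw [homSections_smul_val, map_one, one_smul]
  mul_smul r r' φ := by
    ext V m
    rw [homSections_smul_val, homSections_smul_val, homSections_smul_val, map_mul, mul_smul]
  smul_zero r := by
    ext V m
    rw [homSections_smul_val]
    simp
  smul_add r φ ψ := by
    ext V m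
    simp only [homSections_smul_val, AddSubgroup.coe_add, Pi.add_apply, smul_add]
  add_smul r r' φ := by
    ext V m
    simp only [homSections_smul_val, AddSubgroup.coe_add, Pi.add_apply, map_add, add_smul]
  zero_smul φ := by
    ext V m
    rw [homSections_smul_val, map_zero, zero_smul]
    simp

/-- Restriction of local homomorphisms to a smaller open. -/
def homSectionsRes {U U' : X.Opens} (h : U' ≤ U) : homSections M N U →+ homSections M N U' where
  toFun φ := ⟨fun V => φ.1 ⟨V.1, V.2.trans h⟩, fun V W hVW m =>
    φ.2 ⟨V.1, V.2.trans h⟩ ⟨W.1, W.2.trans h⟩ hVW m⟩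
  map_zero' := rfl
  map_add' _ _ := rfl

variable (M N)

/-- The abelian presheaf `U ↦ Hom(M|_U, N|_U)`. -/
def homPresheaf : TopCat.Presheaf Ab.{u} X where
  obj U := AddCommGrpCat.of (homSections M N U.unop)
  map i := AddCommGrpCat.ofHom (homSectionsRes i.unop.le)
  map_id _ := rfl
  map_comp _ _ := rfl

theorem structure_map_map {U V W : X.Opens} (h : W ≤ V) (h' : V ≤ U) (x : Γ(X, U)) :
    X.presheaf.map (homOfLE h).op (X.presheaf.map (homOfLE h').op x) =
      X.presheaf.map (homOfLE (h.trans h')).op x := by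
  rw [← CategoryTheory.comp_apply, ← Functor.map_comp]; rfl

theorem modules_existsUnique_glue (N : X.Modules) {ι : Type u} (U : ι → X.Opens) (V : X.Opens)
    (hU : ∀ i, U i ≤ V) (hV : V ≤ ⨆ i, U i) (s : ∀ i, Γ(N, U i))
    (hs : ∀ i j, N.presheaf.map (homOfLE (inf_le_left : U i ⊓ U j ≤ U i)).op (s i) =
      N.presheaf.map (homOfLE (inf_le_right : U i ⊓ U j ≤ U j)).op (s j)) :
    ∃! t : Γ(N, V), ∀ i, N.presheaf.map (homOfLE (hU i)).op t = s i :=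
  TopCat.Sheaf.existsUnique_gluing' ⟨N.presheaf, N.isSheaf⟩ U V (fun i => homOfLE (hU i)) hV s hs

theorem map_map_apply (N : X.Modules) {U V W : X.Opens} (h : W ≤ V) (h' : V ≤ U) (x : Γ(N, U)) :
    N.presheaf.map (homOfLE h).op (N.presheaf.map (homOfLE h').op x) =
      N.presheaf.map (homOfLE (h.trans h')).op x := by
  rw [← CategoryTheory.comp_apply, ← Functor.map_comp]; rfl

theorem homPresheaf_isSheaf : (homPresheaf M N).IsSheaf := by
  rw [TopCat.Presheaf.isSheaf_iff_isSheafUniqueGluing]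
  intro ι U sf hsf
  have compat : ∀ (i j : ι) (V : X.Opens) (hi : V ≤ U i) (hj : V ≤ U j),
      (sf i).1 ⟨V, hi⟩ = (sf j).1 ⟨V, hj⟩ := by
    intro i j V hi hj
    exact congrFun (congrArg Subtype.val (hsf i j)) ⟨V, le_inf hi hj⟩
  have glue : ∀ (V : X.Opens) (_ : V ≤ iSup U) (m : Γ(M, V)), ∃! t : Γ(N, V), ∀ i,
      N.presheaf.map (homOfLE (inf_le_left : V ⊓ U i ≤ V)).op t =
        (sf i).1 ⟨V ⊓ U i, inf_le_right⟩
          (M.presheaf.map (homOfLE (inf_le_left : V ⊓ U i ≤ V)).op m) := by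
    intro V hV m
    refine modules_existsUnique_glue N (fun i => V ⊓ U i) V (fun i => inf_le_left)
      (by rw [← inf_iSup_eq]; exact le_inf le_rfl hV) _ ?_
    intro i j
    rw [(sf i).2 ⟨V ⊓ U i, inf_le_right⟩ ⟨V ⊓ U i ⊓ (V ⊓ U j), inf_le_left.trans inf_le_right⟩
        inf_le_left,
      (sf j).2 ⟨V ⊓ U j, inf_le_right⟩ ⟨V ⊓ U i ⊓ (V ⊓ U j), inf_le_right.trans inf_le_right⟩
        inf_le_right, map_map_apply, map_map_apply, compat i j]
  have ext_loc : ∀ (V : X.Opens) (_ : V ≤ iSup U) (t t' : Γ(N, V)),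
      (∀ i, N.presheaf.map (homOfLE (inf_le_left : V ⊓ U i ≤ V)).op t =
        N.presheaf.map (homOfLE (inf_le_left : V ⊓ U i ≤ V)).op t') → t = t' := by
    intro V hV t t' h
    refine (modules_existsUnique_glue N (fun i => V ⊓ U i) V (fun i => inf_le_left)
      (by rw [← inf_iSup_eq]; exact le_inf le_rfl hV)
      (fun i => N.presheaf.map (homOfLE (inf_le_left : V ⊓ U i ≤ V)).op t') ?_).unique h
      (fun _ => rfl)
    intro i j
    rw [map_map_apply, map_map_apply]
  choose F hF hF' using glue
  have hFlin : ∀ (V : X.Opens) (hV : V ≤ iSup U), ∃ G : Γ(M, V) →ₗ[Γ(X, V)] Γ(N, V),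
      ∀ m, G m = F V hV m := fun V hV =>
    ⟨{ toFun := F V hV
       map_add' := fun m m' => ext_loc V hV _ _ fun i => by
        rw [map_add, hF V hV _ i, hF V hV _ i, hF V hV _ i, map_add, map_add]
       map_smul' := fun r m => ext_loc V hV _ _ fun i => by
        rw [RingHom.id_apply, Scheme.Modules.map_smul, hF V hV _ i, hF V hV _ i,
          Scheme.Modules.map_smul, map_smul] }, fun _ => rfl⟩
  choose G hG using hFlin
  have hGloc : ∀ i (V : X.Opens) (hV : V ≤ iSup U) (hi : V ≤ U i), G V hV = (sf i).1 ⟨V, hi⟩ := by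
    intro i V hV hi
    ext m
    rw [hG]
    refine ext_loc V hV _ _ fun j => ?_
    rw [hF V hV m j, (sf i).2 ⟨V, hi⟩ ⟨V ⊓ U j, inf_le_left.trans hi⟩ inf_le_left,
      compat i j (V ⊓ U j) (inf_le_left.trans hi) inf_le_right]
  refine ⟨⟨fun V => G V.1 V.2, ?_⟩, ?_, ?_⟩
  · intro V W h m
    refine ext_loc W.1 W.2 _ _ fun i => ?_
    rw [hG, hG, hF W.1 W.2 _ i, map_map_apply, map_map_apply]
    have := congrArg (N.presheaf.map (homOfLE (inf_le_inf_right (U i) h)).op)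
      (hF V.1 V.2 m i)
    rw [map_map_apply, (sf i).2 ⟨V.1 ⊓ U i, inf_le_right⟩ ⟨W.1 ⊓ U i, inf_le_right⟩,
      map_map_apply] at this
    exact this
  · intro i
    apply Subtype.ext
    funext V
    exact hGloc i V.1 (V.2.trans (le_iSup U i)) V.2
  · intro ψ hψ
    apply Subtype.ext
    funext V
    have hψ' : ∀ i (W : X.Opens) (hW : W ≤ iSup U) (hi : W ≤ U i),
        ψ.1 ⟨W, hW⟩ = (sf i).1 ⟨W, hi⟩ := fun i W hW hi =>
      congrFun (congrArg Subtype.val (hψ i)) ⟨W, hi⟩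
    ext m
    refine ext_loc V.1 V.2 _ _ fun i => ?_
    rw [hG, hF V.1 V.2 m i, ψ.2 V ⟨V.1 ⊓ U i, inf_le_left.trans V.2⟩ inf_le_left,
      hψ' i (V.1 ⊓ U i) (inf_le_left.trans V.2) inf_le_right]

instance homPresheafModule (U : (Opens X)ᵒᵖ) :
    Module (X.ringCatSheaf.obj.obj U) ((homPresheaf M N).obj U) :=
  homSectionsModule U.unop

/-- The internal Hom of two `𝒪_X`-modules, as an `𝒪_X`-module. -/
def sheafHomObj : X.Modules :=
  { val := PresheafOfModules.ofPresheaf (R := X.ringCatSheaf.obj) (homPresheaf M N)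
      (by
        intro U V i r φ
        apply Subtype.ext
        funext W
        exact congrArg (fun t : Γ(X, W.1) =>
          t • (show homSections M N U.unop from φ).1 ⟨W.1, W.2.trans i.unop.le⟩)
          (structure_map_map W.2 i.unop.le r).symm)
    isSheaf := homPresheaf_isSheaf M N }

variable {N} {N' : X.Modules}

/-- A morphism of `𝒪_X`-modules on sections over `U`, as an `𝒪_X(U)`-linear map. -/
def appLinear (g : N ⟶ N') (U : X.Opens) : Γ(N, U) →ₗ[Γ(X, U)] Γ(N', U) where
  toFun := g.app U
  map_add' := map_add _
  map_smul' := g.app_smul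

theorem appLinear_res (g : N ⟶ N') {U V : X.Opens} (h : V ≤ U) (x : Γ(N, U)) :
    N'.presheaf.map (homOfLE h).op (appLinear g U x) =
      appLinear g V (N.presheaf.map (homOfLE h).op x) :=
  (ConcreteCategory.congr_hom (g.mapPresheaf.naturality (homOfLE h).op) x).symm

/-- Postcomposition of local homomorphisms with a morphism `g : N ⟶ N'`. -/
def homSectionsPost (g : N ⟶ N') (U : X.Opens) : homSections M N U →+ homSections M N' U where
  toFun φ := ⟨fun V => appLinear g V.1 ∘ₗ φ.1 V, fun V W h m => by
    rw [LinearMap.comp_apply, LinearMap.comp_apply, appLinear_res, φ.2 V W h m]⟩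
  map_zero' := by
    ext V m
    exact map_zero (appLinear g V.1)
  map_add' φ ψ := by
    ext V m
    exact map_add (appLinear g V.1) _ _

/-- The functor `ℋom(M, -)` from `𝒪_X`-modules to `𝒪_X`-modules. -/
def sheafHom : X.Modules ⥤ X.Modules where
  obj N := sheafHomObj M N
  map {N N'} g :=
    { val := PresheafOfModules.homMk (M₁ := (sheafHomObj M N).val) (M₂ := (sheafHomObj M N').val)
        { app := fun U => AddCommGrpCat.ofHom (homSectionsPost M g U.unop)
          naturality := fun _ _ _ => rfl }
        (by
          intro U r φ
          apply Subtype.ext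
          funext V
          ext m
          exact map_smul (appLinear g V.1) _ _) }
  map_id _ := rfl
  map_comp _ _ := rfl

instance sheafHom_additive : (sheafHom M).Additive where
  map_add := rfl

end InternalHom

section Tensor
variable {X : Scheme.{u}}

/-- The tensor product of two `𝒪_X`-modules: the sheaf associated with
`U ↦ M(U) ⊗_{𝒪_X(U)} N(U)`. -/
def tensor (M N : X.Modules) : X.Modules :=
  (PresheafOfModules.sheafification (𝟙 X.ringCatSheaf.obj)).obj
    (PresheafOfModules.Monoidal.tensorObj (R := X.presheaf) M.val N.val)

/-- The structure sheaf as a module over itself. -/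
def structureModule (X : Scheme.{u}) : X.Modules := SheafOfModules.unit X.ringCatSheaf

/-- The tensor power `L^{⊗ k}` for a natural number `k`. -/
def tensorPow (L : X.Modules) : ℕ → X.Modules
  | 0 => structureModule X
  | k + 1 => tensor (tensorPow L k) L

/-- The dual `ℋom(L, 𝒪_X)`. -/
def dual (L : X.Modules) : X.Modules := sheafHomObj L (structureModule X)

/-- The tensor power `L^{⊗ b}` of an invertible sheaf for an integer `b`; negative powers are the
powers of the dual. -/
def tensorZPow (L : X.Modules) : ℤ → X.Modules
  | Int.ofNat k => tensorPow L k
  | Int.negSucc k => tensorPow (dual L) (k + 1)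

end Tensor

section Derived
variable (X : Scheme.{u})

instance modulesHasDerivedCategory : HasDerivedCategory.{u + 1} X.Modules :=
  HasDerivedCategory.standard _

instance abSheavesHasDerivedCategory :
    HasDerivedCategory.{u + 1} (Sheaf (Opens.grothendieckTopology X) AddCommGrpCat.{u}) :=
  HasDerivedCategory.standard _

/-- Coherent sheaves on a (locally Noetherian) scheme: the `𝒪_X`-modules that locally admit a
finite presentation. -/
def IsCoherent {X : Scheme.{u}} (M : X.Modules) : Prop :=
  SheafOfModules.IsFinitePresentation (R := X.ringCatSheaf) M

/-- The objects of the derived category of `𝒪_X`-modules whose cohomology sheaves are coherent and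
vanish outside a bounded range of degrees (objects of `Plus` are bounded below by definition). -/
def isBoundedCoherent : ObjectProperty (DerivedCategory.Plus X.Modules) := fun F =>
  (∃ s : ℤ, F.IsLE s) ∧
    ∀ j : ℤ, IsCoherent ((DerivedCategory.Plus.homologyFunctor X.Modules j).obj F)

/-- The bounded derived category `D^b(X)` of coherent sheaves. -/
abbrev Db := (isBoundedCoherent X).FullSubcategory

variable {X}

/-- The sheaf `ℰxt^p(A, F) = H^p(Rℋom(A, F))`, where `Rℋom(A, -)` is the right derived functor
of the sheaf Hom `ℋom(A, -)`. -/
def extSheaf (p : ℤ) (A : X.Modules) (F : DerivedCategory.Plus X.Modules) : X.Modules :=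
  (DerivedCategory.Plus.homologyFunctor X.Modules p).obj
    ((sheafHom A).rightDerivedFunctorPlus.obj F)

/-- The cohomology group `H^q(X, E)`, `q ∈ ℤ`, of the abelian sheaf underlying an `𝒪_X`-module:
the group `Hom(ℤ_X, E[q])` in the derived category of abelian sheaves on `X`. For `q ≥ 0` this is
`CategoryTheory.Sheaf.H`. -/
def cohomology (q : ℤ) (E : X.Modules) : Type (u + 1) :=
  ShiftedHom
    ((DerivedCategory.singleFunctor _ 0).obj
      ((constantSheaf (Opens.grothendieckTopology X) AddCommGrpCat.{u}).obj
        (AddCommGrpCat.of (ULift.{u} ℤ))))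
    ((DerivedCategory.singleFunctor _ 0).obj ((SheafOfModules.toSheaf X.ringCatSheaf).obj E)) q

instance cohomologyAddCommGroup (q : ℤ) (E : X.Modules) : AddCommGroup (cohomology q E) :=
  inferInstanceAs (AddCommGroup (ShiftedHom _ _ q))

end Derived

section QuotientGrading
variable {A : Type} [CommRing A] [Algebra ℂ A] (𝒜 : ℕ → Submodule ℂ A)

/-- The grading of `A / (f)` induced by a grading of `A`. -/
def quotientGrading (f : A) (k : ℕ) : Submodule ℂ (A ⧸ Ideal.span {f}) :=
  (𝒜 k).map (Ideal.Quotient.mkₐ ℂ (Ideal.span {f})).toLinearMap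

theorem mk_mem_quotientGrading (f : A) {k : ℕ} {a : A} (ha : a ∈ 𝒜 k) :
    Ideal.Quotient.mkₐ ℂ (Ideal.span {f}) a ∈ quotientGrading 𝒜 f k := ⟨a, ha, rfl⟩

/-- The projection `𝒜 k → (A / (f))_k`. -/
def quotientGradingMk (f : A) (k : ℕ) : 𝒜 k →ₗ[ℂ] quotientGrading 𝒜 f k where
  toFun a := ⟨Ideal.Quotient.mkₐ ℂ (Ideal.span {f}) a.1, mk_mem_quotientGrading 𝒜 f a.2⟩
  map_add' _ _ := rfl
  map_smul' _ _ := rfl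

variable [GradedAlgebra 𝒜]

instance quotientGrading_gradedMonoid (f : A) : SetLike.GradedMonoid (quotientGrading 𝒜 f) where
  one_mem := ⟨1, SetLike.GradedOne.one_mem, rfl⟩
  mul_mem := by
    rintro i j _ _ ⟨a, ha, rfl⟩ ⟨b, hb, rfl⟩
    exact ⟨a * b, SetLike.GradedMul.mul_mem ha hb, rfl⟩

/-- Decomposition of the class of an element of `A` into homogeneous components. -/
def quotientDecomposeAux (f : A) : A →ₐ[ℂ] DirectSum ℕ fun k => quotientGrading 𝒜 f k :=
  (DirectSum.toAlgebra ℂ (fun k => 𝒜 k)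
    (fun k => DirectSum.lof ℂ ℕ (fun k => quotientGrading 𝒜 f k) k ∘ₗ quotientGradingMk 𝒜 f k)
    rfl
    (by
      intro i j a b
      exact (DirectSum.of_mul_of (A := fun k => quotientGrading 𝒜 f k)
        (quotientGradingMk 𝒜 f i a) (quotientGradingMk 𝒜 f j b)).symm)).comp
  (DirectSum.decomposeAlgEquiv 𝒜).toAlgHom

theorem quotientDecomposeAux_of_mem (f : A) {k : ℕ} {a : A} (ha : a ∈ 𝒜 k) :
    quotientDecomposeAux 𝒜 f a =
      DirectSum.of (fun k => quotientGrading 𝒜 f k) k ⟨_, mk_mem_quotientGrading 𝒜 f ha⟩ := by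
  unfold quotientDecomposeAux
  rw [AlgHom.comp_apply]
  have h : (DirectSum.decomposeAlgEquiv 𝒜).toAlgHom a = DirectSum.of (fun k => 𝒜 k) k ⟨a, ha⟩ :=
    DirectSum.decompose_of_mem 𝒜 ha
  rw [h]
  exact DirectSum.toAddMonoid_of _ _ _

/-- The quotient of a graded algebra by a homogeneous element is graded. -/
instance quotientGradedAlgebra {d : ℕ} (f : 𝒜 d) : GradedAlgebra (quotientGrading 𝒜 (f : A)) :=
  GradedAlgebra.ofAlgHom _
    (Ideal.Quotient.liftₐ (Ideal.span {(f : A)}) (quotientDecomposeAux 𝒜 f) (by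
      have h0 : quotientDecomposeAux 𝒜 f (f : A) = 0 := by
        rw [quotientDecomposeAux_of_mem 𝒜 f f.2]
        refine (congrArg _ (Subtype.ext ?_)).trans (map_zero _)
        exact Ideal.Quotient.eq_zero_iff_mem.2 (Ideal.mem_span_singleton_self (f : A))
      intro a ha
      obtain ⟨c, rfl⟩ := Ideal.mem_span_singleton'.1 ha
      rw [map_mul, h0, mul_zero]))
    (by
      apply Ideal.Quotient.algHom_ext
      apply AlgHom.ext
      intro a
      induction a using DirectSum.Decomposition.inductionOn 𝒜 with
      | zero => simp
      | add a b ha hb => rw [map_add, ha, hb, map_add]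
      | @homogeneous i a =>
        change DirectSum.coeAlgHom _ (quotientDecomposeAux 𝒜 f a.1) = _
        rw [quotientDecomposeAux_of_mem 𝒜 f a.2, DirectSum.coeAlgHom_of]
        rfl)
    (by
      rintro i ⟨_, a, ha, rfl⟩
      exact quotientDecomposeAux_of_mem 𝒜 f ha)

/-- The projection `A → A / (f)` as a graded ring homomorphism. -/
def quotientGradedHom (f : A) : GradedRingHom 𝒜 (quotientGrading 𝒜 f) where
  __ := Ideal.Quotient.mk (Ideal.span {f})
  map_mem ha := mk_mem_quotientGrading 𝒜 f ha

theorem irrelevant_le_map_quotient {d : ℕ} (f : 𝒜 d) :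
    HomogeneousIdeal.irrelevant (quotientGrading 𝒜 (f : A)) ≤
      (HomogeneousIdeal.irrelevant 𝒜).map (quotientGradedHom 𝒜 (f : A)) := by
  refine (HomogeneousIdeal.irrelevant_le _).2 ?_
  rintro i hi _ ⟨a, ha, rfl⟩
  exact Ideal.mem_map_of_mem _ (HomogeneousIdeal.mem_irrelevant_of_mem 𝒜 hi ha)

/-- The closed subscheme `V(f)` of `Proj 𝒜` cut out by a homogeneous element `f`, that is
`Proj (A / (f))`. -/
def projZeroLocus {d : ℕ} (f : 𝒜 d) : Scheme.{0} := Proj (quotientGrading 𝒜 (f : A))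

/-- The inclusion `V(f) ⟶ Proj 𝒜`. -/
def projZeroLocusι {d : ℕ} (f : 𝒜 d) : projZeroLocus 𝒜 f ⟶ Proj 𝒜 :=
  Proj.map (quotientGradedHom 𝒜 (f : A)) (irrelevant_le_map_quotient 𝒜 f)

end QuotientGrading

section Twist
variable {A : Type} [CommRing A] [Algebra ℂ A] (𝒜 : ℕ → Submodule ℂ A) [GradedAlgebra 𝒜]

/-- The localization `A_𝔭` of `A` at a point `𝔭` of `Proj 𝒜`; it contains the stalk
`𝒪(k)_𝔭` as its part of degree `k`. -/
abbrev LocAt (x : ProjectiveSpectrum 𝒜) : Type :=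
  Localization.AtPrime x.asHomogeneousIdeal.toIdeal

/-- The functions `s` on an open set `U` of `Proj 𝒜` with values `s(𝔭) ∈ A_𝔭` that are locally
of the form `a / b` with `a`, `b` homogeneous and `deg a = deg b + k`. -/
def isTwistSection (k : ℤ) :
    TopCat.LocalPredicate (X := ProjectiveSpectrum.top 𝒜) (fun x => LocAt 𝒜 x) where
  pred {U} s := ∀ x : U, ∃ V : Opens (ProjectiveSpectrum.top 𝒜), x.1 ∈ V ∧
    ∃ (i j : ℕ) (a : 𝒜 i) (b : 𝒜 j), (i : ℤ) = j + k ∧ ∀ y : U, y.1 ∈ V →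
      (b : A) ∉ ProjectiveSpectrum.asHomogeneousIdeal (𝒜 := 𝒜) y.1 ∧
      algebraMap A (LocAt 𝒜 y.1) b * s y = algebraMap A (LocAt 𝒜 y.1) a
  res {V U} i s hs x := by
    obtain ⟨W, hxW, i', j', a, b, hij, h⟩ := hs ⟨x.1, i.le x.2⟩
    exact ⟨W, hxW, i', j', a, b, hij, fun y hy => h ⟨y.1, i.le y.2⟩ hy⟩
  locality {U} s hs x := by
    obtain ⟨V, hxV, i, hV⟩ := hs x
    obtain ⟨W, hxW, i', j', a, b, hij, h⟩ := hV ⟨x.1, hxV⟩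
    exact ⟨V ⊓ W, ⟨hxV, hxW⟩, i', j', a, b, hij, fun y hy => h ⟨y.1, hy.1⟩ hy.2⟩

theorem exists_homogeneous_notMem (x : ProjectiveSpectrum 𝒜) :
    ∃ (d : ℕ) (b : 𝒜 d), 0 < d ∧ (b : A) ∉ x.asHomogeneousIdeal := by
  by_contra! h
  exact x.not_irrelevant_le
    ((HomogeneousIdeal.irrelevant_le 𝒜).2 fun i hi b hb => h i ⟨b, hb⟩ hi)

/-- Sections of `𝒪(k)` over `U`. -/
def twistSections (k : ℤ) (U : Opens (ProjectiveSpectrum.top 𝒜)) :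
    AddSubgroup (∀ x : U, LocAt 𝒜 x.1) where
  carrier := {s | (isTwistSection 𝒜 k).pred s}
  zero_mem' := fun x => by
    obtain ⟨d, b, hd, hb⟩ := exists_homogeneous_notMem 𝒜 x.1
    have hle : k.natAbs ≤ k.natAbs * d := Nat.le_mul_of_pos_right _ hd
    refine ⟨ProjectiveSpectrum.basicOpen 𝒜 b, hb, (k.natAbs * d + k).toNat, k.natAbs • d,
      0, ⟨b ^ k.natAbs, SetLike.pow_mem_graded _ b.2⟩, ?_, fun y hy => ⟨?_, ?_⟩⟩
    · rw [smul_eq_mul, Int.toNat_of_nonneg (by zify at hle; simp only [Int.natCast_natAbs] at *; have := neg_abs_le k; omega)]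
      push_cast
      rfl
    · exact fun h => hy ((ProjectiveSpectrum.isPrime y.1).mem_of_pow_mem _ h)
    · simp
  add_mem' := fun {s t} hs ht x => by
    obtain ⟨V, hxV, i, j, a, b, hij, h⟩ := hs x
    obtain ⟨W, hxW, i', j', a', b', hij', h'⟩ := ht x
    refine ⟨V ⊓ W, ⟨hxV, hxW⟩, j + i', j + j', ⟨b' * a + b * a', ?_⟩,
      ⟨b * b', SetLike.mul_mem_graded b.2 b'.2⟩, by push_cast; omega, ?_⟩
    · refine add_mem ?_ (SetLike.mul_mem_graded b.2 a'.2)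
      have : j' + i = j + i' := by omega
      exact this ▸ SetLike.mul_mem_graded b'.2 a.2
    · intro y hy
      obtain ⟨h1, h2⟩ := h y hy.1
      obtain ⟨h1', h2'⟩ := h' y hy.2
      refine ⟨fun hmem =>
        ((ProjectiveSpectrum.isPrime y.1).mem_or_mem hmem).elim h1 h1', ?_⟩
      simp only [Pi.add_apply, map_add, map_mul, ← h2, ← h2']
      ring
  neg_mem' := fun {s} hs x => by
    obtain ⟨V, hxV, i, j, a, b, hij, h⟩ := hs x
    refine ⟨V, hxV, i, j, -a, b, hij, fun y hy => ⟨(h y hy).1, ?_⟩⟩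
    rw [Pi.neg_apply, mul_neg, (h y hy).2]
    simp

variable {𝒜}

/-- The value in `A_𝔭` of a function on an open subset of `Proj 𝒜` at a point `𝔭`. -/
def sectionValue {U : (Proj 𝒜).Opens} (x : U) : Γ(Proj 𝒜, U) →+* LocAt 𝒜 x.1 where
  toFun r := ((show (ProjectiveSpectrum.Proj.structureSheaf 𝒜).1.obj (op U) from r).1 x).val
  map_one' := HomogeneousLocalization.val_one
  map_mul' _ _ := HomogeneousLocalization.val_mul _ _
  map_zero' := HomogeneousLocalization.val_zero
  map_add' _ _ := HomogeneousLocalization.val_add _ _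

theorem sectionValue_locally {U : (Proj 𝒜).Opens} (r : Γ(Proj 𝒜, U)) (x : U) :
    ∃ V : Opens (ProjectiveSpectrum.top 𝒜), x.1 ∈ V ∧ ∃ (l : ℕ) (c e : 𝒜 l), ∀ y : U, y.1 ∈ V →
      (e : A) ∉ ProjectiveSpectrum.asHomogeneousIdeal (𝒜 := 𝒜) y.1 ∧
      algebraMap A (LocAt 𝒜 y.1) e * sectionValue y r = algebraMap A (LocAt 𝒜 y.1) c := by
  obtain ⟨V, hxV, iV, ⟨l, c, e, he, hce⟩⟩ :=
    (show (ProjectiveSpectrum.Proj.structureSheaf 𝒜).1.obj (op U) from r).2 x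
  refine ⟨V, hxV, l, c, e, fun y hy => ⟨he ⟨y.1, hy⟩, ?_⟩⟩
  have := congrArg HomogeneousLocalization.val (hce ⟨y.1, hy⟩)
  rw [HomogeneousLocalization.val_mk] at this
  refine (congrArg _ this).trans ?_
  rw [Localization.mk_eq_mk', mul_comm]
  exact IsLocalization.mk'_spec (LocAt 𝒜 y.1) (c : A) ⟨(e : A), he ⟨y.1, hy⟩⟩

/-- Functions act on sections of `𝒪(k)` by pointwise multiplication. -/
instance twistSectionsSMul (k : ℤ) (U : (Proj 𝒜).Opens) :
    SMul Γ(Proj 𝒜, U) (twistSections 𝒜 k U) where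
  smul r s := ⟨fun x => sectionValue x r * s.1 x, fun x => by
    obtain ⟨V, hxV, l, c, e, hV⟩ := sectionValue_locally r x
    obtain ⟨W, hxW, i, j, a, b, hij, hW⟩ := s.2 x
    refine ⟨V ⊓ W, ⟨hxV, hxW⟩, l + i, l + j, ⟨c * a, SetLike.mul_mem_graded c.2 a.2⟩,
      ⟨e * b, SetLike.mul_mem_graded e.2 b.2⟩, by push_cast; omega, fun y hy => ?_⟩
    obtain ⟨h1, h2⟩ := hW y hy.2
    obtain ⟨h3, h4⟩ := hV y hy.1
    refine ⟨fun hmem => ((ProjectiveSpectrum.isPrime y.1).mem_or_mem hmem).elim h3 h1, ?_⟩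
    simp only [map_mul, ← h2, ← h4]
    ring⟩

instance twistSectionsModule (k : ℤ) (U : (Proj 𝒜).Opens) :
    Module Γ(Proj 𝒜, U) (twistSections 𝒜 k U) where
  one_smul s := Subtype.ext (funext fun x =>
    (congrArg (· * s.1 x) (map_one (sectionValue x))).trans (one_mul _))
  mul_smul r r' s := Subtype.ext (funext fun x =>
    (congrArg (· * s.1 x) (map_mul (sectionValue x) r r')).trans (mul_assoc _ _ _))
  smul_zero _ := Subtype.ext (funext fun _ => mul_zero _)
  smul_add _ _ _ := Subtype.ext (funext fun _ => mul_add _ _ _)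
  add_smul r r' s := Subtype.ext (funext fun x =>
    (congrArg (· * s.1 x) (map_add (sectionValue x) r r')).trans (add_mul _ _ _))
  zero_smul s := Subtype.ext (funext fun x =>
    (congrArg (· * s.1 x) (map_zero (sectionValue x))).trans (zero_mul _))

variable (𝒜)

/-- The abelian presheaf of sections of `𝒪(k)`. -/
def twistPresheaf (k : ℤ) : TopCat.Presheaf Ab.{0} (Proj 𝒜) where
  obj U := AddCommGrpCat.of (twistSections 𝒜 k U.unop)
  map i := AddCommGrpCat.ofHom
    { toFun := fun s => ⟨fun x => s.1 ⟨x.1, i.unop.le x.2⟩, (isTwistSection 𝒜 k).res i.unop s.1 s.2⟩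
      map_zero' := rfl
      map_add' := fun _ _ => rfl }
  map_id _ := rfl
  map_comp _ _ := rfl

theorem twistPresheaf_isSheaf (k : ℤ) : (twistPresheaf 𝒜 k).IsSheaf := by
  rw [TopCat.Presheaf.isSheaf_iff_isSheaf_comp (forget Ab)]
  exact TopCat.subpresheafToTypes.isSheaf (isTwistSection 𝒜 k)

instance twistPresheafModule (k : ℤ) (U : (Opens (Proj 𝒜))ᵒᵖ) :
    Module ((Proj 𝒜).ringCatSheaf.obj.obj U) ((twistPresheaf 𝒜 k).obj U) :=
  twistSectionsModule k U.unop

/-- The twisting sheaf `𝒪(k)` on `Proj 𝒜`. -/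
def twist (k : ℤ) : (Proj 𝒜).Modules :=
  { val := PresheafOfModules.ofPresheaf (R := (Proj 𝒜).ringCatSheaf.obj) (twistPresheaf 𝒜 k)
      (fun _ _ _ _ _ => rfl)
    isSheaf := twistPresheaf_isSheaf 𝒜 k }

end Twist

section Toric
open Pointwise

/-- A lattice point as a point of `ℝ^n`. -/
def toReal {n : ℕ} (m : Fin n → ℤ) : Fin n → ℝ := fun i => (m i : ℝ)

/-- A lattice polytope of dimension `n` in `ℝ^n`, given by a finite set of lattice points of which
it is the convex hull. -/
structure LatticePolytope (n : ℕ) where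
  /-- lattice points whose convex hull is the polytope -/
  points : Finset (Fin n → ℤ)
  /-- the polytope has dimension `n` -/
  fullDim : affineSpan ℝ (toReal '' (points : Set (Fin n → ℤ))) = ⊤

namespace LatticePolytope
variable {n : ℕ} (Δ : LatticePolytope n)

/-- The underlying convex set. -/
def carrier : Set (Fin n → ℝ) := convexHull ℝ (toReal '' (Δ.points : Set (Fin n → ℤ)))

/-- The set of points of `Δ` on the hyperplane `⟨m, v⟩ = -c`. -/
def slice (v : Fin n → ℤ) (c : ℤ) : Set (Fin n → ℝ) :=
  {m ∈ Δ.carrier | m ⬝ᵥ toReal v = -(c : ℝ)}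

/-- `v` is the primitive inward conormal of a facet of `Δ` that lies on the hyperplane
`⟨m, v⟩ = -c`. -/
structure IsFacetNormal (v : Fin n → ℤ) (c : ℤ) : Prop where
  primitive : ∀ d : ℤ, (∀ i, d ∣ v i) → IsUnit d
  inward : ∀ m ∈ Δ.carrier, -(c : ℝ) ≤ m ⬝ᵥ toReal v
  nonempty : (Δ.slice v c).Nonempty
  codim_one : Module.finrank ℝ (vectorSpan ℝ (Δ.slice v c)) + 1 = n

/-- `Δ` is reflexive: all facets lie on hyperplanes `⟨m, v_F⟩ = -1`, with `v_F` the primitive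
inward conormal. -/
def IsReflexive : Prop := ∀ v c, Δ.IsFacetNormal v c → c = 1

theorem carrier_nonempty : Δ.carrier.Nonempty := by
  rw [carrier, convexHull_nonempty_iff]
  by_contra h
  rw [Set.not_nonempty_iff_eq_empty] at h
  have h1 := Δ.fullDim
  rw [h, AffineSubspace.span_empty] at h1
  exact AffineSubspace.bot_ne_top _ _ _ h1

/-- The monoid of lattice points `(m, k)` with `m ∈ k Δ`, of the cone over `Δ × {1}`. -/
def coneMonoid : AddSubmonoid ((Fin n → ℤ) × ℕ) where
  carrier := {x | toReal x.1 ∈ (x.2 : ℝ) • Δ.carrier}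
  zero_mem' := by
    rw [Set.mem_ofPred_eq, Prod.snd_zero, Nat.cast_zero, Set.zero_smul_set Δ.carrier_nonempty]
    ext i
    simp [toReal]
  add_mem' := by
    intro x y hx hy
    have hconv : Convex ℝ Δ.carrier := convex_convexHull ℝ _
    have hadd : toReal (x + y).1 = toReal x.1 + toReal y.1 := by
      ext i
      simp [toReal]
    rw [Set.mem_ofPred_eq, hadd, Prod.snd_add, Nat.cast_add,
      hconv.add_smul (Nat.cast_nonneg _) (Nat.cast_nonneg _)]
    exact Set.add_mem_add hx hy

/-- The polytope algebra `S_Δ`: the semigroup algebra over `ℂ` with basis `χ^m t^k`, `m ∈ k Δ`. -/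
abbrev polytopeAlgebra : Type := AddMonoidAlgebra ℂ Δ.coneMonoid

/-- The degree `χ^m t^k ↦ k`. -/
def degree : Δ.coneMonoid →+ ℕ := (AddMonoidHom.snd (Fin n → ℤ) ℕ).comp Δ.coneMonoid.subtype

/-- The grading of `S_Δ` by degree. -/
def grading (k : ℕ) : Submodule ℂ Δ.polytopeAlgebra := AddMonoidAlgebra.gradeBy ℂ Δ.degree k

instance gradingGradedAlgebra : GradedAlgebra Δ.grading :=
  AddMonoidAlgebra.gradeBy.gradedAlgebra Δ.degree

/-- The projective toric variety `X = Proj S_Δ` of the polytope `Δ` (equivalently, of its inner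
normal fan), polarized by the divisor `D_Δ = ∑_F c_F D_F`. -/
def toricVariety : Scheme.{0} := Proj Δ.grading

/-- The sheaf `𝒪_X(k D_Δ)`, which is the twisting sheaf `𝒪(k)` of `Proj S_Δ`. If `Δ` is reflexive
then all `c_F = 1`, so `D_Δ = ∑_F D_F = -K_X` and this is `𝒪_X(-k K_X)`. -/
def anticanonicalSheaf (k : ℤ) : Δ.toricVariety.Modules := twist Δ.grading k

/-- The member of the linear system `|D_Δ|` (which is `|-K_X|` for reflexive `Δ`) defined by
a section `f` of `𝒪_X(D_Δ)`. The space of sections is the degree one part of `S_Δ`; its basis is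
formed by the characters `χ^m`, `m ∈ Δ ∩ ℤ^n`. -/
def hypersurface (f : Δ.grading 1) : Scheme.{0} := projZeroLocus Δ.grading f

/-- The inclusion of the hypersurface `Y` in `X`. -/
def hypersurfaceι (f : Δ.grading 1) : Δ.hypersurface f ⟶ Δ.toricVariety :=
  projZeroLocusι Δ.grading f

/-- The restriction `ℒ` to `Y` of the sheaf `𝒪_X(-(n-1) K_X)`. -/
def lineBundle (f : Δ.grading 1) : (Δ.hypersurface f).Modules :=
  (Scheme.Modules.pullback (Δ.hypersurfaceι f)).obj (Δ.anticanonicalSheaf ((n : ℤ) - 1))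

end LatticePolytope
end Toric
end

end BraneVertex

/-! The sheaf `lineBundle` is free of rank one on each open set of Y where a section `g` of degree
one does not vanish, and so are its integral tensor powers A. Since a homomorphism out of a free
module of rank one is an arbitrary choice of image for the generator, ℋom(A, -) is locally the
identity functor; it is therefore exact, and ℰxt^p(A, F) ≅ ℋom(A, H^p(F)) (`nonempty_extSheaf_iso`).
If some cohomology of this sheaf is nonzero, then H^p(F) ≠ 0, which puts p in [r, s]. The bound 0 ≤
q is formal.

The upper bound on q is the vanishing of cohomology above dim Y, obtained from a small affine cover.
Sections of ℋom(A, H^p(F)) extend from principal open sets after multiplication by a power of the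
equation, because H^p(F) is quasi-coherent; this is enough for Serre vanishing on the affine sets
where A is free (`subsingleton_H'_of_isAffineOpen`). By Mayer–Vietoris, the cohomology of a union of
N such sets vanishes in degrees ≥ N (`subsingleton_H'_foldr`).

It remains to cover Y by at most n sets {g ≠ 0} (`exists_le_coversHypersurface`). The monomials of
the points spanning Δ have no common zero. The algebra S_Δ is a domain of transcendence degree at
most n + 1, so modulo f ≠ 0 any n + 1 elements of degree one satisfy a nontrivial homogeneous
relation. Projecting from a point of projective space off the hypersurface of this relation leaves
one element fewer, still without common zeros on Y; this is repeated until n are left. -/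

namespace BraneVertex
universe w u
noncomputable section

/-! ### Free abelian sheaves on open sets, which represent sections -/

section FreeSheaf
variable {T : Type u} [TopologicalSpace T]

/-- The free abelian sheaf generated by an open subset. -/
abbrev freeSheaf (T : Type u) [TopologicalSpace T] :
    Opens T ⥤ Sheaf (Opens.grothendieckTopology T) AddCommGrpCat.{u} :=
  yoneda ⋙ (Functor.whiskeringRight _ _ _).obj AddCommGrpCat.free ⋙ presheafToSheaf _ _

/-- Morphisms from the free abelian sheaf on `U` are sections over `U`. -/
def freeSheafHomEquiv (U : Opens T) (F : Sheaf (Opens.grothendieckTopology T) AddCommGrpCat.{u}) :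
    ((freeSheaf T).obj U ⟶ F) ≃ F.obj.obj (op U) :=
  ((sheafificationAdjunction (Opens.grothendieckTopology T) AddCommGrpCat.{u}).homEquiv _ _).trans
    (((AddCommGrpCat.adj.whiskerRight (Opens T)ᵒᵖ).homEquiv (yoneda.obj U) F.obj).trans
      yonedaEquiv)

theorem freeSheafHomEquiv_comp {U : Opens T}
    {F G : Sheaf (Opens.grothendieckTopology T) AddCommGrpCat.{u}}
    (φ : (freeSheaf T).obj U ⟶ F) (g : F ⟶ G) :
    freeSheafHomEquiv U G (φ ≫ g) = g.hom.app (op U) (freeSheafHomEquiv U F φ) := by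
  dsimp only [freeSheafHomEquiv, Equiv.trans_apply]
  erw [Adjunction.homEquiv_naturality_right, Adjunction.homEquiv_naturality_right]
  rfl

/-- The bijection comes from adjunctions of sets and Yoneda, so additivity is not built in. It holds
because a morphism is recovered by applying it to the universal section, the image of the identity.
-/
theorem freeSheafHomEquiv_sub {U : Opens T}
    {F : Sheaf (Opens.grothendieckTopology T) AddCommGrpCat.{u}}
    (φ ψ : (freeSheaf T).obj U ⟶ F) :
    freeSheafHomEquiv U F (φ - ψ) = freeSheafHomEquiv U F φ - freeSheafHomEquiv U F ψ := by
  have h : ∀ χ : (freeSheaf T).obj U ⟶ F, freeSheafHomEquiv U F χ =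
      χ.hom.app (op U) (freeSheafHomEquiv U _ (𝟙 _)) := fun χ => by
    rw [← freeSheafHomEquiv_comp, Category.id_comp]
  rw [h φ, h ψ, h (φ - ψ)]
  rfl

theorem freeSheafHomEquiv_map_comp {U V : Opens T} (i : V ⟶ U)
    {F : Sheaf (Opens.grothendieckTopology T) AddCommGrpCat.{u}}
    (φ : (freeSheaf T).obj U ⟶ F) :
    freeSheafHomEquiv V F ((freeSheaf T).map i ≫ φ) =
      F.obj.map i.op (freeSheafHomEquiv U F φ) := by
  have h₁ := (sheafificationAdjunction (Opens.grothendieckTopology T)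
    AddCommGrpCat.{u}).homEquiv_naturality_left
      (((Functor.whiskeringRight _ _ _).obj AddCommGrpCat.free).map (yoneda.map i)) φ
  have h₂ := (AddCommGrpCat.adj.whiskerRight (Opens T)ᵒᵖ).homEquiv_naturality_left (yoneda.map i)
    ((sheafificationAdjunction (Opens.grothendieckTopology T) AddCommGrpCat.{u}).homEquiv _ _ φ)
  exact (congrArg (fun t => yonedaEquiv
    ((AddCommGrpCat.adj.whiskerRight (Opens T)ᵒᵖ).homEquiv (yoneda.obj V) F.obj t)) h₁).trans
    ((congrArg yonedaEquiv h₂).trans (yonedaEquiv_naturality _ i).symm)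

/-- Epimorphisms of sheaves are locally surjective, and a morphism from `freeSheaf` is a section. -/
theorem exists_local_lift {F G : Sheaf (Opens.grothendieckTopology T) AddCommGrpCat.{u}}
    (g : F ⟶ G) [Epi g] {U : Opens T} (φ : (freeSheaf T).obj U ⟶ G) {x : T} (hx : x ∈ U) :
    ∃ (V : Opens T) (i : V ⟶ U) (ψ : (freeSheaf T).obj V ⟶ F), x ∈ V ∧
      ψ ≫ g = (freeSheaf T).map i ≫ φ := by
  have h := (TopCat.Sheaf.isLocallySurjective_iff_epi (X := TopCat.of T) g).2 ‹Epi g›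
  obtain ⟨V, i, ⟨t, ht⟩, hxV⟩ :=
    (TopCat.Presheaf.isLocallySurjective_iff (X := TopCat.of T) g.hom).1 h U
    (freeSheafHomEquiv U G φ) x hx
  refine ⟨V, homOfLE i, (freeSheafHomEquiv V F).symm t, hxV, (freeSheafHomEquiv V G).injective ?_⟩
  rw [freeSheafHomEquiv_comp, Equiv.apply_symm_apply, freeSheafHomEquiv_map_comp, ht]
  rfl

/-- A sheaf has a single section over the empty set, so the identity of this object equals its zero
morphism. -/
theorem isZero_freeSheaf_bot : IsZero ((freeSheaf T).obj ⊥) := by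
  refine (IsZero.iff_id_eq_zero _).2 ((freeSheafHomEquiv ⊥ _).injective ?_)
  have h := (TopCat.Sheaf.isTerminalOfEmpty (X := TopCat.of T) ((freeSheaf T).obj ⊥)).isZero
  exact (AddCommGrpCat.subsingleton_of_isZero h).elim _ _

/-- The constant sheaf `ℤ` is the free abelian sheaf generated by the whole space. -/
def constantSheafIsoFreeSheaf : (constantSheaf (Opens.grothendieckTopology T) AddCommGrpCat.{u}).obj
    (AddCommGrpCat.of (ULift.{u} ℤ)) ≅ (freeSheaf T).obj ⊤ :=
  (presheafToSheaf _ _).mapIso (NatIso.ofComponents (fun U =>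
    haveI : Unique ((yoneda.obj (⊤ : Opens T)).obj U) := ⟨⟨homOfLE le_top⟩, fun _ => rfl⟩
    (AddEquiv.ulift.trans
      (FreeAbelianGroup.uniqueEquiv ((yoneda.obj (⊤ : Opens T)).obj U)).symm).toAddCommGrpIso)
    (by
      intro U V i
      apply ConcreteCategory.hom_ext
      intro x
      change x.down • FreeAbelianGroup.of (homOfLE le_top) =
        FreeAbelianGroup.map ((yoneda.obj (⊤ : Opens T)).map i)
          (x.down • FreeAbelianGroup.of (homOfLE le_top))
      rw [map_zsmul, FreeAbelianGroup.map_of_apply]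
      rfl))

end FreeSheaf

/-! ### Local vanishing of cohomology classes -/

section LocalVanishing
variable {T : Type u} [TopologicalSpace T]
  [HasExt.{w} (Sheaf (Opens.grothendieckTopology T) AddCommGrpCat.{u})]
open Abelian

theorem cohomologyPresheaf_map_apply (F : Sheaf (Opens.grothendieckTopology T) AddCommGrpCat.{u})
    {q : ℕ} {U V : Opens T} (i : V ⟶ U) (α : Ext ((freeSheaf T).obj U) F q) :
    (F.cohomologyPresheaf q).map i.op α =
      (Ext.mk₀ ((freeSheaf T).map i)).comp α (zero_add q) := rfl

/-- Cohomology classes of positive degree vanish locally. -/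
theorem exists_restrict_eq_zero (q : ℕ) :
    ∀ (F : Sheaf (Opens.grothendieckTopology T) AddCommGrpCat.{u}) (U : Opens T)
      (α : Ext ((freeSheaf T).obj U) F (q + 1)) (x : T), x ∈ U →
      ∃ (V : Opens T) (i : V ⟶ U), x ∈ V ∧
        (Ext.mk₀ ((freeSheaf T).map i)).comp α (zero_add _) = 0 := by
  induction q with
  | zero =>
    intro F U α x hx
    -- Embedding `F` in an injective sheaf makes a class of degree one the coboundary of a section
    -- `φ` of the quotient; where `φ` lifts to the injective, the class dies.
    let S : ShortComplex (Sheaf (Opens.grothendieckTopology T) AddCommGrpCat.{u}) :=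
      ShortComplex.mk (Injective.ι F) (cokernel.π _) (cokernel.condition _)
    have hS : S.ShortExact :=
      { exact := ShortComplex.exact_cokernel (Injective.ι F)
        mono_f := inferInstanceAs (Mono (Injective.ι F))
        epi_g := inferInstanceAs (Epi (cokernel.π (Injective.ι F))) }
    obtain ⟨β, hβ⟩ := Ext.covariant_sequence_exact₁ _ hS α
      (haveI : Injective S.X₂ := inferInstanceAs (Injective (Injective.under F))
       Ext.eq_zero_of_injective _) (zero_add 1)
    obtain ⟨φ, rfl⟩ := (Ext.mk₀_bijective _ _).2 β
    have := hS.epi_g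
    obtain ⟨V, i, ψ, hxV, hψ⟩ := exists_local_lift S.g φ hx
    refine ⟨V, i, hxV, ?_⟩
    rw [← hβ, Ext.mk₀_comp_mk₀_assoc, ← hψ, ← Ext.mk₀_comp_mk₀_assoc, hS.comp_extClass,
      Ext.comp_zero]
  | succ q ih =>
    intro F U α x hx
    -- Dimension shifting along the same sequence lowers the degree by one.
    let S : ShortComplex (Sheaf (Opens.grothendieckTopology T) AddCommGrpCat.{u}) :=
      ShortComplex.mk (Injective.ι F) (cokernel.π _) (cokernel.condition _)
    have hS : S.ShortExact :=
      { exact := ShortComplex.exact_cokernel (Injective.ι F)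
        mono_f := inferInstanceAs (Mono (Injective.ι F))
        epi_g := inferInstanceAs (Epi (cokernel.π (Injective.ι F))) }
    obtain ⟨β, hβ⟩ := Ext.covariant_sequence_exact₁ _ hS α
      (haveI : Injective S.X₂ := inferInstanceAs (Injective (Injective.under F))
       Ext.eq_zero_of_injective _) rfl
    obtain ⟨V, i, hxV, hV⟩ := ih S.X₃ U β x hx
    refine ⟨V, i, hxV, ?_⟩
    rw [← hβ, ← Ext.comp_assoc _ _ _ (zero_add _) rfl (by omega), hV, Ext.zero_comp]

end LocalVanishing

theorem ext_eq_zero_of_isZero {C : Type*} [Category* C] [Abelian C] [HasExt.{w} C] {A B : C}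
    (hA : IsZero A) {q : ℕ} (x : Abelian.Ext A B q) : x = 0 := by
  rw [← Abelian.Ext.mk₀_id_comp x, (IsZero.iff_id_eq_zero _).1 hA, Abelian.Ext.mk₀_zero,
    Abelian.Ext.zero_comp]

/-! ### Mayer–Vietoris and the cohomology of finite unions -/

section MayerVietoris
variable {T : Type u} [TopologicalSpace T]
  [HasExt.{w} (Sheaf (Opens.grothendieckTopology T) AddCommGrpCat.{u})]
  (F : Sheaf (Opens.grothendieckTopology T) AddCommGrpCat.{u})
open Abelian

/-- By exactness, `α` is the image of some `β` under the connecting map, and this map kills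
differences of restrictions from `U` and `V`. -/
theorem eq_zero_of_restrict_eq_zero {q : ℕ} {U V W : Opens T} (hU : U ≤ W) (hV : V ≤ W)
    (hW : W = U ⊔ V) (α : F.H' (q + 1) W)
    (hαU : (F.cohomologyPresheaf (q + 1)).map (homOfLE hU).op α = 0)
    (hαV : (F.cohomologyPresheaf (q + 1)).map (homOfLE hV).op α = 0)
    (h : ∀ β : F.H' q (U ⊓ V), ∃ (γ : F.H' q U) (γ' : F.H' q V),
      β = (F.cohomologyPresheaf q).map (homOfLE (inf_le_left : U ⊓ V ≤ U)).op γ -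
        (F.cohomologyPresheaf q).map (homOfLE (inf_le_right : U ⊓ V ≤ V)).op γ') : α = 0 := by
  subst hW
  let S := Opens.mayerVietorisSquare U V
  have hex := S.sequence_exact F q (q + 1) rfl
  have h2 := (ShortComplex.ab_exact_iff _).1 (hex.exact 2) α (by
    refine (S.toBiprod_apply F α).trans ?_
    have h0 : ((F.cohomologyPresheaf (q + 1)).map S.f₂₄.op α,
        (F.cohomologyPresheaf (q + 1)).map S.f₃₄.op α) = 0 := Prod.ext hαU hαV
    rw [h0]
    exact map_zero _)
  obtain ⟨β, hβ⟩ := h2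
  obtain ⟨γ, γ', hγ⟩ := h β
  have h3 := S.fromBiprod_biprodIsoProd_inv_apply F (n := q) γ γ'
  have h4 : β = S.fromBiprod F q ((AddCommGrpCat.biprodIsoProd _ _).inv ⟨γ, γ'⟩) :=
    hγ.trans h3.symm
  rw [← hβ, h4]
  exact ConcreteCategory.congr_hom (S.fromBiprod_δ F q (q + 1) rfl)
    ((AddCommGrpCat.biprodIsoProd _ _).inv ⟨γ, γ'⟩)

theorem eq_zero_of_restrict_eq_zero_of_subsingleton {q : ℕ} {U V W : Opens T} (hU : U ≤ W)
    (hV : V ≤ W) (hW : W = U ⊔ V) (α : F.H' (q + 1) W)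
    (hαU : (F.cohomologyPresheaf (q + 1)).map (homOfLE hU).op α = 0)
    (hαV : (F.cohomologyPresheaf (q + 1)).map (homOfLE hV).op α = 0)
    (h : Subsingleton (F.H' q (U ⊓ V))) : α = 0 :=
  eq_zero_of_restrict_eq_zero F hU hV hW α hαU hαV fun _ => ⟨0, 0, h.elim _ _⟩

theorem eq_zero_of_restrict_eq_zero_of_sections {U V W : Opens T} (hU : U ≤ W) (hV : V ≤ W)
    (hW : W = U ⊔ V) (α : F.H' 1 W)
    (hαU : (F.cohomologyPresheaf 1).map (homOfLE hU).op α = 0)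
    (hαV : (F.cohomologyPresheaf 1).map (homOfLE hV).op α = 0)
    (h : ∀ t : F.obj.obj (op (U ⊓ V)), ∃ (s : F.obj.obj (op U)) (s' : F.obj.obj (op V)),
      t = F.obj.map (homOfLE (inf_le_left : U ⊓ V ≤ U)).op s -
        F.obj.map (homOfLE (inf_le_right : U ⊓ V ≤ V)).op s') : α = 0 := by
  refine eq_zero_of_restrict_eq_zero F hU hV hW α hαU hαV fun β => ?_
  obtain ⟨φ, rfl⟩ := (Ext.mk₀_bijective _ _).2 β
  obtain ⟨s, s', hs⟩ := h (freeSheafHomEquiv _ F φ)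
  obtain ⟨ψ, rfl⟩ := (freeSheafHomEquiv _ F).surjective s
  obtain ⟨ψ', rfl⟩ := (freeSheafHomEquiv _ F).surjective s'
  refine ⟨Ext.mk₀ ψ, Ext.mk₀ ψ', ?_⟩
  have hφ : φ = (freeSheaf T).map (homOfLE (inf_le_left : U ⊓ V ≤ U)) ≫ ψ -
      (freeSheaf T).map (homOfLE (inf_le_right : U ⊓ V ≤ V)) ≫ ψ' := by
    apply (freeSheafHomEquiv _ F).injective
    rw [freeSheafHomEquiv_sub, freeSheafHomEquiv_map_comp, freeSheafHomEquiv_map_comp, hs]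
  rw [cohomologyPresheaf_map_apply, cohomologyPresheaf_map_apply, Ext.mk₀_comp_mk₀,
    Ext.mk₀_comp_mk₀, hφ]
  exact map_sub Ext.addEquiv₀.symm _ _

theorem subsingleton_H'_bot (q : ℕ) : Subsingleton (F.H' q (⊥ : Opens T)) :=
  subsingleton_of_forall_eq 0 fun x =>
    ext_eq_zero_of_isZero (A := (freeSheaf T).obj ⊥) (B := F) isZero_freeSheaf_bot x

/-- If a class of open sets is stable under intersection and its members have no higher cohomology,
then the cohomology of a union of `k` members vanishes in degrees `≥ k`. -/
theorem subsingleton_H'_foldr (P : Opens T → Prop) (hP : ∀ U V, P U → P V → P (U ⊓ V))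
    (hF : ∀ U, P U → ∀ q : ℕ, Subsingleton (F.H' (q + 1) U)) (l : List (Opens T)) :
    (∀ U ∈ l, P U) → ∀ q : ℕ, l.length ≤ q → Subsingleton (F.H' q (l.foldr (· ⊔ ·) ⊥)) := by
  induction hk : l.length generalizing l with
  | zero =>
    intro _ q _
    rw [List.length_eq_zero_iff] at hk
    subst hk
    exact subsingleton_H'_bot F q
  | succ k ih =>
    obtain ⟨U, l, rfl⟩ := List.exists_cons_of_length_eq_add_one hk
    rw [List.length_cons, add_left_inj] at hk
    intro hl q hq
    obtain ⟨q, rfl⟩ : ∃ q', q = q' + 1 := ⟨q - 1, by omega⟩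
    -- The intersection of `U` with the rest is again a union of `k` members of the class. The
    -- induction hypothesis thus serves twice: in degree `q + 1` for the rest, in degree `q` for the
    -- intersection.
    have hinf : U ⊓ l.foldr (· ⊔ ·) ⊥ = (l.map (U ⊓ ·)).foldr (· ⊔ ·) ⊥ := by
      clear ih hl hk
      induction l with
      | nil => simp
      | cons V l ih => simp only [List.foldr_cons, List.map_cons, inf_sup_left, ih]
    refine subsingleton_of_forall_eq 0 fun α => ?_
    refine eq_zero_of_restrict_eq_zero_of_subsingleton F (U := U) (V := l.foldr (· ⊔ ·) ⊥)
      le_sup_left le_sup_right rfl α ?_ ?_ ?_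
    · exact (hF U (hl U List.mem_cons_self) q).elim _ _
    · exact (ih l hk (fun V hV => hl V (List.mem_cons_of_mem _ hV)) (q + 1) (by omega)).elim _ _
    · rw [hinf]
      refine ih _ (by rw [List.length_map, hk]) ?_ q (by omega)
      intro V' hV'
      obtain ⟨V, hV, rfl⟩ := List.mem_map.1 hV'
      exact hP _ _ (hl U List.mem_cons_self) (hl V (List.mem_cons_of_mem _ hV))

theorem ext_subsingleton_of_iso {C : Type*} [Category* C] [Abelian C] [HasExt.{w} C] {A A' B : C}
    (e : A ≅ A') {q : ℕ} (h : Subsingleton (Ext A' B q)) : Subsingleton (Ext A B q) := by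
  refine ⟨fun x y => ?_⟩
  have h' : ∀ z : Ext A B q, (Ext.mk₀ e.hom).comp ((Ext.mk₀ e.inv).comp z (zero_add q))
      (zero_add q) = z := fun z => by
    rw [Ext.mk₀_comp_mk₀_assoc, Iso.hom_inv_id, Ext.mk₀_id_comp]
  rw [← h' x, ← h' y, h.elim ((Ext.mk₀ e.inv).comp x (zero_add q))]

theorem subsingleton_H_of_H' {q : ℕ} (h : Subsingleton (F.H' q (⊤ : Opens T))) :
    Subsingleton (F.H q) :=
  ext_subsingleton_of_iso (A' := (freeSheaf T).obj ⊤) (B := F) constantSheafIsoFreeSheaf h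

end MayerVietoris

/-! ### Formal vanishing of the cohomology of modules -/

section Cohomology
variable {X : Scheme.{u}} (E : X.Modules)
open Abelian

/-- The t-structure leaves no morphisms from an object in degree 0 to one in degrees ≥ `-q` > 0. -/
theorem subsingleton_cohomology_of_neg {q : ℤ} (hq : q < 0) : Subsingleton (cohomology q E) := by
  refine ⟨fun x y => ?_⟩
  have : ((DerivedCategory.singleFunctor _ 0).obj
      ((SheafOfModules.toSheaf X.ringCatSheaf).obj E)⟦q⟧).IsGE (-q) :=
    DerivedCategory.TStructure.t.isGE_shift _ 0 q (-q) (by omega)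
  exact (DerivedCategory.TStructure.t.zero x 0 (-q) (by omega)).trans
    (DerivedCategory.TStructure.t.zero y 0 (-q) (by omega)).symm

theorem subsingleton_cohomology_of_H' {q : ℕ}
    [HasExt.{w} (Sheaf (Opens.grothendieckTopology X) AddCommGrpCat.{u})]
    (h : Subsingleton (Sheaf.H' ((SheafOfModules.toSheaf X.ringCatSheaf).obj E) q (⊤ : X.Opens))) :
    Subsingleton (cohomology (q : ℤ) E) := by
  have := subsingleton_H_of_H' _ h
  exact (Ext.homEquiv (X := (constantSheaf (Opens.grothendieckTopology X) AddCommGrpCat.{u}).obj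
    (AddCommGrpCat.of (ULift.{u} ℤ))) (Y := (SheafOfModules.toSheaf X.ringCatSheaf).obj E)
    (n := q)).symm.subsingleton

theorem subsingleton_cohomology_of_isZero (hE : IsZero E) (q : ℤ) :
    Subsingleton (cohomology q E) := by
  refine ⟨fun x y => ?_⟩
  have : IsZero ((DerivedCategory.singleFunctor _ 0).obj
      ((SheafOfModules.toSheaf X.ringCatSheaf).obj E)⟦q⟧) :=
    Functor.map_isZero (shiftFunctor _ q) (Functor.map_isZero _
      (Functor.map_isZero (SheafOfModules.toSheaf X.ringCatSheaf) hE))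
  exact this.eq_of_tgt x y

end Cohomology

/-! ### Serre vanishing on affine open sets -/

section AffineVanishing

theorem smul_pow_surjective {A M : Type*} [CommRing A] [AddCommGroup M] [Module A M] {c : A}
    (hc : Function.Surjective fun m : M => c • m) (N : ℕ) :
    Function.Surjective fun m : M => c ^ N • m := by
  have := hc.iterate N
  simpa only [smul_iterate] using this

theorem smul_pow_injective {A M : Type*} [CommRing A] [AddCommGroup M] [Module A M] {c : A}
    (hc : Function.Injective fun m : M => c • m) (N : ℕ) :
    Function.Injective fun m : M => c ^ N • m := by
  have := hc.iterate N
  simpa only [smul_iterate] using this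

/-- Over a union of two principal open sets with sum `1` (up to the unit `f + g`), a section over
the intersection is a difference of sections. -/
theorem exists_eq_sub_of_extend {A M M₁ M₂ M₁₂ : Type*} [CommRing A]
    [AddCommGroup M] [AddCommGroup M₁] [AddCommGroup M₂] [AddCommGroup M₁₂]
    [Module A M] [Module A M₁] [Module A M₂] [Module A M₁₂]
    (r₁ : M →ₗ[A] M₁) (r₂ : M →ₗ[A] M₂) (r₁₂ : M →ₗ[A] M₁₂)
    (p₁ : M₁ →ₗ[A] M₁₂) (p₂ : M₂ →ₗ[A] M₁₂) (hp₁ : ∀ m, p₁ (r₁ m) = r₁₂ m)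
    (hp₂ : ∀ m, p₂ (r₂ m) = r₁₂ m) (f g h : A)
    (h₁ : Function.Surjective fun m : M₁ => (f * ((f + g) * h)) • m)
    (h₂ : Function.Surjective fun m : M₂ => (g * ((f + g) * h)) • m)
    (h₁₂ : Function.Injective fun m : M₁₂ => (f * g * ((f + g) * h)) • m)
    (hext : ∀ t : M₁₂, ∃ (N : ℕ) (m : M), r₁₂ m = (f * g * ((f + g) * h)) ^ N • t) (t : M₁₂) :
    ∃ s s', t = p₁ s - p₂ s' := by
  obtain ⟨N, m, hm⟩ := hext t
  -- A partition of unity: each term of the binomial expansion contains f^N or g^N.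
  obtain ⟨a, b, hab⟩ : ∃ a b, a * f ^ N + b * g ^ N = (f + g) ^ (2 * N) :=
    Ideal.mem_span_pair.1 (Ideal.add_pow_mem_of_pow_mem_of_le
      (I := Ideal.span {f ^ N, g ^ N}) (m := N) (n := N)
      (Ideal.subset_span (by simp)) (Ideal.subset_span (by simp)) (by omega))
  -- With σ = f + g, formally t = m / (fgσh)^N = b m / (f^N σ^(3N) h^N) + a m / (g^N σ^(3N) h^N).
  -- The two summands are `s` and `-s'`, written with denominators (fσh)^(3N) and (gσh)^(3N).
  obtain ⟨s, hs⟩ := smul_pow_surjective h₁ (3 * N) (((h ^ (2 * N)) * b * f ^ (2 * N)) • r₁ m)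
  obtain ⟨s', hs'⟩ := smul_pow_surjective h₂ (3 * N) ((-(h ^ (2 * N)) * a * g ^ (2 * N)) • r₂ m)
  refine ⟨s, s', (smul_pow_injective h₁₂ (3 * N)) ?_⟩
  have e₁ := congrArg p₁ hs
  have e₂ := congrArg p₂ hs'
  simp only [map_smul, hp₁, hp₂] at e₁ e₂
  have e₁' := congrArg (g ^ (3 * N) • ·) e₁
  have e₂' := congrArg (f ^ (3 * N) • ·) e₂
  have e₃ := congrArg ((f * g * ((f + g) * h)) ^ (2 * N) • ·) hm
  simp only [smul_smul] at e₁' e₂' e₃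
  simp only [smul_sub]
  have c₁ : (f * g * ((f + g) * h)) ^ (3 * N) = g ^ (3 * N) * (f * ((f + g) * h)) ^ (3 * N) := by
    rw [← mul_pow]
    ring
  have c₂ : (f * g * ((f + g) * h)) ^ (3 * N) = f ^ (3 * N) * (g * ((f + g) * h)) ^ (3 * N) := by
    rw [← mul_pow]
    ring
  have c₃ : (f * g * ((f + g) * h)) ^ (3 * N) =
    (f * g * ((f + g) * h)) ^ (2 * N) * (f * g * ((f + g) * h)) ^ N := by ring
  nth_rewrite 2 [c₁]
  nth_rewrite 2 [c₂]
  rw [c₃, ← e₃, e₁', e₂', ← sub_smul]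
  congr 1
  rw [mul_pow, mul_pow _ h, ← hab]
  ring

variable {X : Scheme.{u}}

theorem map_smul_homOfLE (E : X.Modules) {U V : X.Opens} (h : V ≤ U) (r : Γ(X, U)) (m : Γ(E, U)) :
    E.presheaf.map (homOfLE h).op (r • m) =
      X.presheaf.map (homOfLE h).op r • E.presheaf.map (homOfLE h).op m :=
  Scheme.Modules.map_smul E (homOfLE h) r m

theorem isUnit_map_of_le_basicOpen {U V : X.Opens} (hV : V ≤ U) (c : Γ(X, U))
    (hc : V ≤ X.basicOpen c) : IsUnit (X.presheaf.map (homOfLE hV).op c) := by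
  have := (X.toRingedSpace.isUnit_res_basicOpen c).map (X.presheaf.map (homOfLE hc).op).hom
  rw [← structure_map_map hc (X.basicOpen_le c)]
  exact this

/-- Sections of `E` over principal open subsets of `U` extend to `U` after multiplication by
a power of the equation. -/
def ExtendsFromBasicOpens (E : X.Modules) (U : X.Opens) : Prop :=
  ∀ (f : Γ(X, U)) (t : Γ(E, X.basicOpen f)), ∃ (N : ℕ) (m : Γ(E, U)),
    E.presheaf.map (homOfLE (X.basicOpen_le f)).op m =
      X.presheaf.map (homOfLE (X.basicOpen_le f)).op (f ^ N) • t

theorem exists_eq_sub_of_extendsFromBasicOpens {E : X.Modules} {U : X.Opens}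
    (hE : ExtendsFromBasicOpens E U) (f g h : Γ(X, U)) (U₁ U₂ : X.Opens)
    (hU₁ : U₁ = X.basicOpen (f * ((f + g) * h))) (hU₂ : U₂ = X.basicOpen (g * ((f + g) * h)))
    (t : Γ(E, U₁ ⊓ U₂)) :
    ∃ (s : Γ(E, U₁)) (s' : Γ(E, U₂)),
      t = E.presheaf.map (homOfLE (inf_le_left : U₁ ⊓ U₂ ≤ U₁)).op s -
        E.presheaf.map (homOfLE (inf_le_right : U₁ ⊓ U₂ ≤ U₂)).op s' := by
  have h₁ : U₁ ≤ U := hU₁.trans_le (X.basicOpen_le _)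
  have h₂ : U₂ ≤ U := hU₂.trans_le (X.basicOpen_le _)
  have h₁₂ : U₁ ⊓ U₂ ≤ U := inf_le_left.trans h₁
  have heq : U₁ ⊓ U₂ = X.basicOpen (f * g * ((f + g) * h)) := by
    rw [hU₁, hU₂]
    simp only [Scheme.basicOpen_mul]
    ext1
    simp only [Opens.coe_inf]
    tauto_set
  -- All section groups become modules over the single ring Γ(X, U), so that the algebraic lemma
  -- applies.
  let _ := Module.compHom Γ(E, U₁) (X.presheaf.map (homOfLE h₁).op).hom
  let _ := Module.compHom Γ(E, U₂) (X.presheaf.map (homOfLE h₂).op).hom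
  let _ := Module.compHom Γ(E, U₁ ⊓ U₂) (X.presheaf.map (homOfLE h₁₂).op).hom
  let r : ∀ {V : X.Opens} (hV : V ≤ U),
      letI := Module.compHom Γ(E, V) (X.presheaf.map (homOfLE hV).op).hom
      Γ(E, U) →ₗ[Γ(X, U)] Γ(E, V) := fun {V} hV =>
    letI := Module.compHom Γ(E, V) (X.presheaf.map (homOfLE hV).op).hom
    { toFun := E.presheaf.map (homOfLE hV).op
      map_add' := map_add _
      map_smul' := map_smul_homOfLE E hV }
  let p₁ : Γ(E, U₁) →ₗ[Γ(X, U)] Γ(E, U₁ ⊓ U₂) :=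
    { toFun := E.presheaf.map (homOfLE inf_le_left).op
      map_add' := map_add _
      map_smul' := fun a m => (map_smul_homOfLE E inf_le_left _ m).trans
        (congrArg (· • _) (structure_map_map inf_le_left h₁ a)) }
  let p₂ : Γ(E, U₂) →ₗ[Γ(X, U)] Γ(E, U₁ ⊓ U₂) :=
    { toFun := E.presheaf.map (homOfLE inf_le_right).op
      map_add' := map_add _
      map_smul' := fun a m => (map_smul_homOfLE E inf_le_right _ m).trans
        (congrArg (· • _) (structure_map_map inf_le_right h₂ a)) }
  refine exists_eq_sub_of_extend (r h₁) (r h₂) (r h₁₂) p₁ p₂ (map_map_apply E inf_le_left h₁)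
    (map_map_apply E inf_le_right h₂) f g h ?_ ?_ ?_ ?_ t
  · have hu := isUnit_map_of_le_basicOpen h₁ _ hU₁.le
    exact fun m => ⟨(↑hu.unit⁻¹ : Γ(X, U₁)) • m, (smul_smul _ _ m).trans (by
      rw [IsUnit.mul_val_inv]
      exact one_smul _ m)⟩
  · have hu := isUnit_map_of_le_basicOpen h₂ _ hU₂.le
    exact fun m => ⟨(↑hu.unit⁻¹ : Γ(X, U₂)) • m, (smul_smul _ _ m).trans (by
      rw [IsUnit.mul_val_inv]
      exact one_smul _ m)⟩
  · exact fun m m' hm => (IsUnit.smul_left_cancel (α := Γ(X, U₁ ⊓ U₂)) (β := Γ(E, U₁ ⊓ U₂))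
      (isUnit_map_of_le_basicOpen h₁₂ _ heq.le)).1 hm
  · generalize f * g * ((f + g) * h) = c at heq
    intro t
    obtain ⟨N, m, hm⟩ := hE c (E.presheaf.map (homOfLE heq.ge).op t)
    refine ⟨N, m, ?_⟩
    have := congrArg (E.presheaf.map (homOfLE heq.le).op) hm
    rw [map_smul_homOfLE, map_map_apply, map_map_apply, structure_map_map] at this
    refine this.trans ?_
    congr 1
    exact ConcreteCategory.congr_hom (E.presheaf.map_id _) t

/-- This matches the action of Γ(X, U) on a module restricted to its spectrum with the action
through restriction of functions on X. -/
theorem _root_.AlgebraicGeometry.IsAffineOpen.map_appIso_inv_fromSpec {U : X.Opens}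
    (hU : IsAffineOpen U) (W : (Spec Γ(X, U)).Opens) (hW : hU.fromSpec ''ᵁ W ≤ U) (r : Γ(X, U)) :
    (hU.fromSpec.appIso W).inv ((Spec Γ(X, U)).presheaf.map W.leTop.op
      ((Scheme.ΓSpecIso Γ(X, U)).inv r)) = X.presheaf.map (homOfLE hW).op r := by
  have : (Scheme.ΓSpecIso Γ(X, U)).inv ≫ (Spec Γ(X, U)).presheaf.map W.leTop.op ≫
      (hU.fromSpec.appIso W).inv = X.presheaf.map (homOfLE hW).op := by
    rw [← Category.assoc, Iso.comp_inv_eq, Scheme.Hom.appIso_hom', Scheme.Hom.map_appLE,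
      Scheme.Hom.appLE, hU.fromSpec_app_self, Category.assoc, ← Functor.map_comp]
    rfl
  exact ConcreteCategory.congr_hom this r

/-- Sections of a quasi-coherent sheaf over principal open subsets of an affine open set extend
after multiplication by a power of the equation. -/
theorem extendsFromBasicOpens_of_isQuasicoherent (E : X.Modules) [E.IsQuasicoherent]
    {U : X.Opens} (hU : IsAffineOpen U) : ExtendsFromBasicOpens E U := by
  intro f t
  have hloc := (isIso_fromTildeΓ_iff_isLocalizing (E.restrict hU.fromSpec)).1 inferInstance f
  have hV : hU.fromSpec ''ᵁ PrimeSpectrum.basicOpen f = X.basicOpen f :=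
    hU.fromSpec_image_basicOpen f
  have hT : hU.fromSpec ''ᵁ ⊤ = U := by
    rw [Scheme.Hom.image_top_eq_opensRange, hU.opensRange_fromSpec]
  -- Quasi-coherence says that sections over D(f) are a localization of the global ones; only the
  -- surjectivity half is needed.
  obtain ⟨⟨m, ⟨_, N, rfl⟩⟩, hm⟩ := hloc.surj
    (show Γ(E, hU.fromSpec ''ᵁ PrimeSpectrum.basicOpen f) from
      E.presheaf.map (homOfLE hV.le).op t)
  refine ⟨N, E.presheaf.map (homOfLE hT.ge).op (show Γ(E, hU.fromSpec ''ᵁ ⊤) from m), ?_⟩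
  have hle : hU.fromSpec ''ᵁ PrimeSpectrum.basicOpen f ≤ U := hV.le.trans (X.basicOpen_le f)
  have hm' : X.presheaf.map (homOfLE hle).op (f ^ N) • E.presheaf.map (homOfLE hV.le).op t =
      E.presheaf.map (homOfLE (Scheme.Hom.image_mono _ le_top)).op
        (show Γ(E, hU.fromSpec ''ᵁ ⊤) from m) := by
    rw [← hU.map_appIso_inv_fromSpec _ hle]
    exact hm
  have := congrArg (E.presheaf.map (homOfLE hV.ge).op) hm'
  rw [map_smul_homOfLE, map_map_apply, map_map_apply, structure_map_map] at this
  rw [map_map_apply, ← this]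
  congr 1
  exact ConcreteCategory.congr_hom (E.presheaf.map_id _) t

variable [HasExt.{w} (Sheaf (Opens.grothendieckTopology X) AddCommGrpCat.{u})]

theorem cohomologyPresheaf_map_map (F : Sheaf (Opens.grothendieckTopology X) AddCommGrpCat.{u})
    {q : ℕ} {U V W : X.Opens} (h : W ≤ V) (h' : V ≤ U) (α : F.H' q U) :
    (F.cohomologyPresheaf q).map (homOfLE h).op ((F.cohomologyPresheaf q).map (homOfLE h').op α) =
      (F.cohomologyPresheaf q).map (homOfLE (h.trans h')).op α := by
  rw [← CategoryTheory.comp_apply, ← Functor.map_comp]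
  rfl

theorem restrict_eq_zero_of_le (F : Sheaf (Opens.grothendieckTopology X) AddCommGrpCat.{u})
    {q : ℕ} {U V W : X.Opens} (h : W ≤ V) (h' : V ≤ U) {α : F.H' q U}
    (hα : (F.cohomologyPresheaf q).map (homOfLE h').op α = 0) :
    (F.cohomologyPresheaf q).map (homOfLE (h.trans h')).op α = 0 := by
  rw [← cohomologyPresheaf_map_map F h h', hα, map_zero]

/-- Serre vanishing on an affine open set: if sections extend from principal open subsets, then
higher cohomology vanishes. -/
theorem subsingleton_H'_basicOpen {E : X.Modules} {U : X.Opens} (hU : IsAffineOpen U)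
    (hE : ExtendsFromBasicOpens E U) (q : ℕ) : ∀ h : Γ(X, U), Subsingleton
      (Sheaf.H' ((SheafOfModules.toSheaf X.ringCatSheaf).obj E) (q + 1) (X.basicOpen h)) := by
  let F := (SheafOfModules.toSheaf X.ringCatSheaf).obj E
  induction q using Nat.strong_induction_on with | _ q ih => ?_
  intro h
  refine subsingleton_of_forall_eq 0 fun α => ?_
  have hle : ∀ f : Γ(X, U), X.basicOpen (f * h) ≤ X.basicOpen h := fun f => by
    rw [Scheme.basicOpen_mul]; exact inf_le_right
  -- `I` consists of the `f` for which `α` dies on D(fh). The aim is to show that it contains a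
  -- power of `h`, since D(h^N h) = D(h).
  let I : Ideal Γ(X, U) :=
    { carrier := {f | (F.cohomologyPresheaf (q + 1)).map (homOfLE (hle f)).op α = 0}
      zero_mem' := by
        have hb : X.basicOpen (0 * h) = ⊥ := by rw [zero_mul, Scheme.basicOpen_zero]
        have := subsingleton_H'_bot F (q + 1)
        rw [← hb] at this
        exact this.elim _ _
      smul_mem' := fun a f hf => by
        have h' : X.basicOpen ((a * f) * h) ≤ X.basicOpen (f * h) := by
          rw [mul_assoc, Scheme.basicOpen_mul]; exact inf_le_right
        exact restrict_eq_zero_of_le F h' (hle f) hf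
      add_mem' := fun {f g} hf hg => by
        have hf' : X.basicOpen (f * ((f + g) * h)) ≤ X.basicOpen (f * h) := by
          rw [mul_left_comm, Scheme.basicOpen_mul]; exact inf_le_right
        have hg' : X.basicOpen (g * ((f + g) * h)) ≤ X.basicOpen (g * h) := by
          rw [mul_left_comm, Scheme.basicOpen_mul]; exact inf_le_right
        have hf'' : X.basicOpen (f * ((f + g) * h)) ≤ X.basicOpen ((f + g) * h) := by
          rw [Scheme.basicOpen_mul]; exact inf_le_right
        have hg'' : X.basicOpen (g * ((f + g) * h)) ≤ X.basicOpen ((f + g) * h) := by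
          rw [Scheme.basicOpen_mul]; exact inf_le_right
        -- Where f + g is invertible, f or g is invertible too, so two sets on which `α` dies cover
        -- D((f + g)h). Mayer–Vietoris then needs vanishing in degree `q` on their intersection,
        -- which is again principal; for `q = 0` the splitting of sections replaces it.
        have hunion : X.basicOpen ((f + g) * h) =
            X.basicOpen (f * ((f + g) * h)) ⊔ X.basicOpen (g * ((f + g) * h)) := by
          refine le_antisymm ?_ (sup_le hf'' hg'')
          rw [Scheme.basicOpen_mul X f, Scheme.basicOpen_mul X g, ← inf_sup_right]
          refine le_inf ?_ le_rfl
          rw [Scheme.basicOpen_mul]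
          exact inf_le_left.trans (Scheme.basicOpen_add_le X f g)
        have r₁ := restrict_eq_zero_of_le F hf' (hle f) hf
        have r₂ := restrict_eq_zero_of_le F hg' (hle g) hg
        rw [← cohomologyPresheaf_map_map F hf'' (hle _)] at r₁
        rw [← cohomologyPresheaf_map_map F hg'' (hle _)] at r₂
        cases q with
        | zero =>
          exact eq_zero_of_restrict_eq_zero_of_sections F hf'' hg'' hunion _ r₁ r₂
            (exists_eq_sub_of_extendsFromBasicOpens hE f g h _ _ rfl rfl)
        | succ q =>
          refine eq_zero_of_restrict_eq_zero_of_subsingleton F hf'' hg'' hunion _ r₁ r₂ ?_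
          rw [← Scheme.basicOpen_mul]
          exact ih q (Nat.lt_succ_self q) _ }
  have hmem : h ∈ I.radical := by
    by_contra hn
    -- Otherwise a prime containing `I` but not `h` gives a point of D(h). The class vanishes on
    -- some D(f) around this point, so `f` lies in `I` and hence in the prime, a contradiction.
    obtain ⟨p, hp, hle', hdisj⟩ := Ideal.exists_le_prime_disjoint I (Submonoid.powers h) (by
      rw [Set.disjoint_left]
      rintro _ hx ⟨n, rfl⟩
      exact hn ⟨n, hx⟩)
    let x : X := hU.fromSpec ⟨p, hp⟩
    have hx : ∀ f : Γ(X, U), x ∈ X.basicOpen f ↔ f ∉ p := fun f => by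
      have := hU.fromSpec_preimage_basicOpen f
      have h' : (⟨p, hp⟩ : PrimeSpectrum Γ(X, U)) ∈ hU.fromSpec ⁻¹ᵁ X.basicOpen f ↔
          (⟨p, hp⟩ : PrimeSpectrum Γ(X, U)) ∈ PrimeSpectrum.basicOpen f :=
        iff_of_eq (congrArg (fun V => (⟨p, hp⟩ : PrimeSpectrum Γ(X, U)) ∈ V) this)
      exact h'
    have hxh : x ∈ X.basicOpen h := (hx h).2 fun hm =>
      Set.disjoint_left.1 hdisj hm (Submonoid.mem_powers h)
    obtain ⟨V, i, hxV, hV⟩ := exists_restrict_eq_zero q F (X.basicOpen h) α x hxh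
    obtain ⟨f, hfV, hxf⟩ := hU.exists_basicOpen_le ⟨x, hxV⟩ (X.basicOpen_le h hxh)
    refine (hx f).1 hxf (hle' ?_)
    have : X.basicOpen (f * h) ≤ V := by
      rw [Scheme.basicOpen_mul]; exact inf_le_left.trans hfV
    exact restrict_eq_zero_of_le F this i.le hV
  obtain ⟨N, hN⟩ := hmem
  have hb : X.basicOpen h ≤ X.basicOpen (h ^ N * h) := by
    rw [← pow_succ, Scheme.basicOpen_pow _ _ (Nat.succ_pos N)]
  have := restrict_eq_zero_of_le F hb (hle _) hN
  refine Eq.trans ?_ this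
  exact (ConcreteCategory.congr_hom ((F.cohomologyPresheaf (q + 1)).map_id _) α).symm

theorem subsingleton_H'_of_isAffineOpen {E : X.Modules} {U : X.Opens} (hU : IsAffineOpen U)
    (hE : ExtendsFromBasicOpens E U) (q : ℕ) :
    Subsingleton (Sheaf.H' ((SheafOfModules.toSheaf X.ringCatSheaf).obj E) (q + 1) U) := by
  have := subsingleton_H'_basicOpen hU hE q 1
  rwa [Scheme.basicOpen_of_isUnit _ isUnit_one] at this

end AffineVanishing

/-! ### Modules free of rank one and local homomorphisms out of them -/

section Basis
variable {X : Scheme.{u}}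

/-- The section `e` of `M` over `U` is a basis of the `𝒪_U`-module `M|_U`. -/
def IsBasisOn (M : X.Modules) (U : X.Opens) (e : Γ(M, U)) : Prop :=
  ∀ (V : X.Opens) (h : V ≤ U),
    Function.Bijective fun r : Γ(X, V) => r • M.presheaf.map (homOfLE h).op e

/-- `M` is free of rank one over `U`. -/
def IsFreeOn (M : X.Modules) (U : X.Opens) : Prop := ∃ e, IsBasisOn M U e

variable {M : X.Modules}

theorem IsBasisOn.restrict {U : X.Opens} {e : Γ(M, U)} (he : IsBasisOn M U e) {V : X.Opens}
    (h : V ≤ U) : IsBasisOn M V (M.presheaf.map (homOfLE h).op e) := by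
  intro W hW
  simp only [map_map_apply]
  exact he W (hW.trans h)

theorem IsFreeOn.mono {U V : X.Opens} (hM : IsFreeOn M U) (h : V ≤ U) : IsFreeOn M V :=
  hM.elim fun _ he => ⟨_, he.restrict h⟩

/-- Injectivity makes coordinates unique, so coordinates found locally agree on overlaps and glue.
Generation therefore only has to be checked near each point. -/
theorem isBasisOn_of_locally {U : X.Opens} (e : Γ(M, U))
    (inj : ∀ (V : X.Opens) (h : V ≤ U) (r : Γ(X, V)),
      r • M.presheaf.map (homOfLE h).op e = 0 → r = 0)
    (surj : ∀ (V : X.Opens) (_ : V ≤ U) (m : Γ(M, V)) (x : X), x ∈ V →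
      ∃ (W : X.Opens) (hW : W ≤ V) (hWU : W ≤ U) (r : Γ(X, W)), x ∈ W ∧
        r • M.presheaf.map (homOfLE hWU).op e = M.presheaf.map (homOfLE hW).op m) :
    IsBasisOn M U e := by
  intro V hV
  have inj' : ∀ (V : X.Opens) (h : V ≤ U), Function.Injective fun r : Γ(X, V) =>
      r • M.presheaf.map (homOfLE h).op e := by
    intro V h r r' hr
    refine sub_eq_zero.1 (inj V h _ ?_)
    rw [sub_smul]
    exact sub_eq_zero.2 hr
  refine ⟨inj' V hV, fun m => ?_⟩
  choose W hWV hWU r hx hr using fun x : V => surj V hV m x.1 x.2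
  have hres : ∀ (x : V) (W' : X.Opens) (h : W' ≤ W x), X.presheaf.map (homOfLE h).op (r x) •
      M.presheaf.map (homOfLE (h.trans (hWU x))).op e =
        M.presheaf.map (homOfLE (h.trans (hWV x))).op m := by
    intro x W' h
    rw [← map_map_apply M h (hWU x), ← map_map_apply M h (hWV x), ← map_smul_homOfLE, hr]
  have hcov : V ≤ ⨆ x : V, W x := fun x hxV => Opens.mem_iSup.2 ⟨⟨x, hxV⟩, hx ⟨x, hxV⟩⟩
  obtain ⟨t, ht, -⟩ := modules_existsUnique_glue (structureModule X) W V hWV hcov r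
    (fun x y => inj' (W x ⊓ W y) (inf_le_left.trans (hWU x))
      ((hres x _ inf_le_left).trans (hres y _ inf_le_right).symm))
  refine ⟨t, ?_⟩
  refine (modules_existsUnique_glue M W V hWV hcov
    (fun x => M.presheaf.map (homOfLE (hWV x)).op m) fun x y => ?_).unique (fun x => ?_)
      (fun _ => rfl)
  · rw [map_map_apply, map_map_apply]
  · refine (map_smul_homOfLE M (hWV x) (show Γ(X, V) from t) _).trans ?_
    rw [map_map_apply, ← hr]
    exact congrArg (· • _) (ht x)

theorem isBasisOn_structureModule (U : X.Opens) :
    IsBasisOn (structureModule X) U (show Γ(structureModule X, U) from (1 : Γ(X, U))) := by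
  intro V h
  have : ∀ r : Γ(X, V), r • (structureModule X).presheaf.map (homOfLE h).op
      (show Γ(structureModule X, U) from (1 : Γ(X, U))) = r := fun r =>
    (congrArg (r * ·) (map_one (X.presheaf.map (homOfLE h).op).hom)).trans (mul_one r)
  simp only [this]
  exact Function.bijective_id

/-- The coordinate of a section with respect to a basis. -/
def IsBasisOn.coord {U : X.Opens} {e : Γ(M, U)} (he : IsBasisOn M U e) :
    Γ(X, U) ≃ₗ[Γ(X, U)] Γ(M, U) :=
  LinearEquiv.ofBijective (LinearMap.toSpanSingleton Γ(X, U) Γ(M, U) e) (by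
    have := he U le_rfl
    have h1 : M.presheaf.map (homOfLE (le_refl U)).op e = e :=
      ConcreteCategory.congr_hom (M.presheaf.map_id _) e
    rw [h1] at this
    exact this)

theorem IsBasisOn.coord_apply {U : X.Opens} {e : Γ(M, U)} (he : IsBasisOn M U e) (r : Γ(X, U)) :
    he.coord r = r • e := rfl

variable (N : X.Modules)

/-- Local homomorphisms out of a free module of rank one are determined by the image of the basis,
which can be arbitrary. -/
theorem IsBasisOn.eval_bijective {U : X.Opens} {e : Γ(M, U)} (he : IsBasisOn M U e) :
    Function.Bijective fun φ : homSections M N U => φ.1 ⟨U, le_rfl⟩ e := by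
  constructor
  · intro φ ψ h
    apply Subtype.ext
    funext V
    ext m
    obtain ⟨r, rfl⟩ := (he V.1 V.2).2 m
    simp only [map_smul]
    rw [← φ.2 ⟨U, le_rfl⟩ V V.2 e, ← ψ.2 ⟨U, le_rfl⟩ V V.2 e]
    exact congrArg (fun n => r • N.presheaf.map (homOfLE V.2).op n) h
  · intro n
    refine ⟨⟨fun V => LinearMap.toSpanSingleton _ _ (N.presheaf.map (homOfLE V.2).op n) ∘ₗ
      (he.restrict V.2).coord.symm.toLinearMap, ?_⟩, ?_⟩
    · intro V W h m
      obtain ⟨r, rfl⟩ := (he.restrict V.2).coord.surjective m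
      simp only [LinearMap.comp_apply, LinearEquiv.coe_coe, LinearEquiv.symm_apply_apply,
        LinearMap.toSpanSingleton_apply]
      have h1 : M.presheaf.map (homOfLE h).op ((he.restrict V.2).coord r) =
          (he.restrict W.2).coord (X.presheaf.map (homOfLE h).op r) := by
        rw [IsBasisOn.coord_apply, IsBasisOn.coord_apply, map_smul_homOfLE, map_map_apply]
      rw [h1, LinearEquiv.symm_apply_apply, map_smul_homOfLE, map_map_apply]
    · have h1 : N.presheaf.map (homOfLE (le_refl U)).op n = n :=
        ConcreteCategory.congr_hom (N.presheaf.map_id _) n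
      have h2 : (he.restrict le_rfl).coord (1 : Γ(X, U)) = e :=
        (one_smul _ _).trans (ConcreteCategory.congr_hom (M.presheaf.map_id _) e)
      simp only [LinearMap.comp_apply, LinearEquiv.coe_coe, LinearMap.toSpanSingleton_apply, h1]
      rw [(LinearEquiv.symm_apply_eq _).2 h2.symm, one_smul]

theorem eval_restrict {U V : X.Opens} (h : V ≤ U) (φ : homSections M N U) (e : Γ(M, U)) :
    (homSectionsRes h φ).1 ⟨V, le_rfl⟩ (M.presheaf.map (homOfLE h).op e) =
      N.presheaf.map (homOfLE h).op (φ.1 ⟨U, le_rfl⟩ e) :=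
  (φ.2 ⟨U, le_rfl⟩ ⟨V, h⟩ h e).symm

theorem eval_smul {U : X.Opens} (r : Γ(X, U)) (φ : homSections M N U) (e : Γ(M, U)) :
    (r • φ).1 ⟨U, le_rfl⟩ e = r • φ.1 ⟨U, le_rfl⟩ e := by
  rw [homSections_smul_val, LinearMap.smul_apply]
  exact congrArg (· • _) (ConcreteCategory.congr_hom (X.presheaf.map_id _) r)

theorem IsFreeOn.dual {U : X.Opens} (hM : IsFreeOn M U) : IsFreeOn (dual M) U := by
  obtain ⟨e, he⟩ := hM
  obtain ⟨φ, hφ⟩ := (he.eval_bijective (structureModule X)).2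
    (show Γ(structureModule X, U) from (1 : Γ(X, U)))
  refine ⟨φ, fun V h => ?_⟩
  refine (Function.Bijective.of_comp_iff' ((he.restrict h).eval_bijective (structureModule X))
    _).1 ?_
  have h1 : ∀ r : Γ(X, V), (r • homSectionsRes h φ).1 ⟨V, le_rfl⟩
      (M.presheaf.map (homOfLE h).op e) = r • (structureModule X).presheaf.map (homOfLE h).op
        (show Γ(structureModule X, U) from (1 : Γ(X, U))) := fun r => by
    rw [eval_smul, eval_restrict]
    exact congrArg (fun t => r • (structureModule X).presheaf.map (homOfLE h).op t) hφ
  have h2 := isBasisOn_structureModule U V h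
  simp only [← h1] at h2
  exact h2

/-- Over an open set where `M` is free of rank one, `ℋom(M, N)` is isomorphic to `N`. -/
theorem ExtendsFromBasicOpens.sheafHom {U : X.Opens} (hM : IsFreeOn M U)
    (hN : ExtendsFromBasicOpens N U) : ExtendsFromBasicOpens (sheafHomObj M N) U := by
  obtain ⟨e, he⟩ := hM
  intro f t
  have hle := X.basicOpen_le f
  obtain ⟨k, n, hn⟩ := hN f ((show homSections M N (X.basicOpen f) from t).1 ⟨_, le_rfl⟩
    (M.presheaf.map (homOfLE hle).op e))
  obtain ⟨φ, rfl⟩ := (he.eval_bijective N).2 n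
  refine ⟨k, φ, ((he.restrict hle).eval_bijective N).1 ?_⟩
  refine (eval_restrict N hle φ e).trans (hn.trans ?_)
  exact (eval_smul N (X.presheaf.map (homOfLE hle).op (f ^ k))
    (show homSections M N (X.basicOpen f) from t) (M.presheaf.map (homOfLE hle).op e)).symm

end Basis

/-! ### Tensor powers of modules free of rank one -/

section TensorBasis
variable {X : Scheme.{u}}
open TensorProduct

/-- The presheaf `U ↦ M(U) ⊗ N(U)`. -/
abbrev tensorPresheaf (M N : X.Modules) : PresheafOfModules X.ringCatSheaf.obj :=
  PresheafOfModules.Monoidal.tensorObj (R := X.presheaf) M.val N.val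

/-- The canonical map `M(U) ⊗ N(U) → (M ⊗ N)(U)`. -/
def tensorMk (M N : X.Modules) (U : X.Opens) :
    Γ(M, U) ⊗[Γ(X, U)] Γ(N, U) →ₗ[Γ(X, U)] Γ(tensor M N, U) where
  toFun := ((PresheafOfModules.sheafificationHomEquiv (𝟙 X.ringCatSheaf.obj)
    (𝟙 (tensor M N))).app (op U)).hom
  map_add' := map_add _
  map_smul' := map_smul _

theorem tensorMk_restrict {M N : X.Modules} {U V : X.Opens} (h : V ≤ U) (m : Γ(M, U))
    (n : Γ(N, U)) :
    (tensor M N).presheaf.map (homOfLE h).op (tensorMk M N U (m ⊗ₜ n)) =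
      tensorMk M N V (M.presheaf.map (homOfLE h).op m ⊗ₜ N.presheaf.map (homOfLE h).op n) := by
  have := PresheafOfModules.naturality_apply
    (PresheafOfModules.sheafificationHomEquiv (𝟙 X.ringCatSheaf.obj) (𝟙 (tensor M N)))
    (homOfLE h).op (m ⊗ₜ n)
  exact this.symm

theorem tensorMk_locally_injective {M N : X.Modules} {U : X.Opens}
    (t : Γ(M, U) ⊗[Γ(X, U)] Γ(N, U)) (ht : tensorMk M N U t = 0) (x : X) (hx : x ∈ U) :
    ∃ (V : X.Opens) (h : V ≤ U), x ∈ V ∧ (tensorPresheaf M N).map (homOfLE h).op t = 0 := by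
  have h := Presheaf.equalizerSieve_mem (Opens.grothendieckTopology X)
    (toSheafify (Opens.grothendieckTopology X) (tensorPresheaf M N).presheaf)
    (show (tensorPresheaf M N).presheaf.obj (op U) from t) 0 (ht.trans (map_zero _).symm)
  obtain ⟨V, i, hi, hxV⟩ := h x hx
  exact ⟨V, i.le, hxV, hi.trans (map_zero _)⟩

theorem tensorMk_locally_surjective {M N : X.Modules} {U : X.Opens}
    (t : Γ(tensor M N, U)) (x : X) (hx : x ∈ U) :
    ∃ (V : X.Opens) (h : V ≤ U) (s : Γ(M, V) ⊗[Γ(X, V)] Γ(N, V)), x ∈ V ∧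
      tensorMk M N V s = (tensor M N).presheaf.map (homOfLE h).op t := by
  have h := Presheaf.imageSieve_mem (Opens.grothendieckTopology X)
    (toSheafify (Opens.grothendieckTopology X) (tensorPresheaf M N).presheaf)
    (show (sheafify _ (tensorPresheaf M N).presheaf).obj (op U) from t)
  obtain ⟨V, i, ⟨s, hs⟩, hxV⟩ := h x hx
  exact ⟨V, i.le, s, hxV, hs⟩

theorem exists_eq_smul_tmul {R M N : Type*} [CommRing R] [AddCommGroup M] [AddCommGroup N]
    [Module R M] [Module R N] {e : M} {e' : N} (he : ∀ m, ∃ r : R, r • e = m)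
    (he' : ∀ n, ∃ r : R, r • e' = n) (t : M ⊗[R] N) : ∃ r : R, r • (e ⊗ₜ[R] e') = t := by
  induction t with
  | zero => exact ⟨0, zero_smul _ _⟩
  | tmul m n =>
    obtain ⟨r, rfl⟩ := he m
    obtain ⟨r', rfl⟩ := he' n
    exact ⟨r * r', by rw [TensorProduct.smul_tmul_smul]⟩
  | add s t hs ht =>
    obtain ⟨r, rfl⟩ := hs
    obtain ⟨r', rfl⟩ := ht
    exact ⟨r + r', add_smul _ _ _⟩

theorem eq_zero_of_smul_tmul {R M N : Type*} [CommRing R] [AddCommGroup M] [AddCommGroup N]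
    [Module R M] [Module R N] {e : M} {e' : N} (he : Function.Bijective fun r : R => r • e)
    (he' : Function.Bijective fun r : R => r • e') {r : R} (h : r • (e ⊗ₜ[R] e') = 0) : r = 0 := by
  let φ := LinearEquiv.ofBijective (LinearMap.toSpanSingleton R M e) he
  let ψ := LinearEquiv.ofBijective (LinearMap.toSpanSingleton R N e') he'
  have h1 : φ.symm e = 1 := (LinearEquiv.symm_apply_eq _).2 (one_smul R e).symm
  have h2 : ψ.symm e' = 1 := (LinearEquiv.symm_apply_eq _).2 (one_smul R e').symm
  have := congrArg (TensorProduct.lid R R ∘ TensorProduct.congr φ.symm ψ.symm) h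
  simpa [h1, h2] using this

/-- The tensor product is a sheafification, so its sections and their relations come from the
presheaf tensor product only locally; `isBasisOn_of_locally` accepts that. -/
theorem IsFreeOn.tensor {M N : X.Modules} {U : X.Opens} (hM : IsFreeOn M U) (hN : IsFreeOn N U) :
    IsFreeOn (tensor M N) U := by
  obtain ⟨e, he⟩ := hM
  obtain ⟨e', he'⟩ := hN
  refine ⟨tensorMk M N U (e ⊗ₜ e'), isBasisOn_of_locally _ ?_ ?_⟩
  · intro V h r hr
    rw [tensorMk_restrict, ← map_smul] at hr
    choose W hW hxW h0 using fun x : V => tensorMk_locally_injective _ hr x.1 x.2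
    refine (modules_existsUnique_glue (structureModule X) W V hW
      (fun x hx => Opens.mem_iSup.2 ⟨⟨x, hx⟩, hxW ⟨x, hx⟩⟩) (fun _ => 0) ?_).unique
      (y₁ := r) (y₂ := (0 : Γ(structureModule X, V))) ?_ (fun _ => map_zero _)
    · intro i j
      rw [map_zero, map_zero]
    · intro x
      refine eq_zero_of_smul_tmul ((he.restrict h) (W x) (hW x)) ((he'.restrict h) (W x) (hW x)) ?_
      refine Eq.trans ?_ (h0 x)
      exact ((tensorPresheaf M N).map_smul (homOfLE (hW x)).op r
        (M.presheaf.map (homOfLE h).op e ⊗ₜ N.presheaf.map (homOfLE h).op e')).symm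
  · intro V h t x hx
    obtain ⟨W, hW, s, hxW, hs⟩ := tensorMk_locally_surjective t x hx
    obtain ⟨r, rfl⟩ := exists_eq_smul_tmul (he W (hW.trans h)).2 (he' W (hW.trans h)).2 s
    refine ⟨W, hW, hW.trans h, r, hxW, ?_⟩
    rw [← hs, tensorMk_restrict, map_smul]

theorem IsFreeOn.tensorPow {M : X.Modules} {U : X.Opens} (hM : IsFreeOn M U) (k : ℕ) :
    IsFreeOn (tensorPow M k) U := by
  induction k with
  | zero => exact ⟨_, isBasisOn_structureModule U⟩
  | succ k ih => exact ih.tensor hM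

theorem IsFreeOn.tensorZPow {M : X.Modules} {U : X.Opens} (hM : IsFreeOn M U) (b : ℤ) :
    IsFreeOn (tensorZPow M b) U := by
  cases b with
  | ofNat k => exact hM.tensorPow k
  | negSucc k => exact hM.dual.tensorPow (k + 1)

end TensorBasis

/-! ### Pullback of modules free of rank one -/

section Pullback
variable {X Y : Scheme.{u}}

/-- Finality makes the comparison morphism `pullbackObjUnitToUnit` invertible. It holds because the
whole space is a terminal object of each comma category. -/
instance opensMap_final (f : X ⟶ Y) : (Opens.map f.base).Final := by
  constructor
  intro U
  have : IsTerminal (StructuredArrow.mk (S := U) (T := Opens.map f.base) (Y := ⊤)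
      (homOfLE le_top)) :=
    IsTerminal.ofUniqueHom (fun A => StructuredArrow.homMk (homOfLE le_top) rfl)
      (fun A m => by ext; exact Subsingleton.elim _ _)
  exact isConnected_of_isTerminal _ this


/-- The pullback of the structure sheaf is the structure sheaf. -/
def pullbackStructureModuleIso (f : X ⟶ Y) :
    (Scheme.Modules.pullback f).obj (structureModule Y) ≅ structureModule X := by
  have : (SheafOfModules.pushforward.{u} f.toRingCatSheafHom).IsRightAdjoint :=
    (Scheme.Modules.pullbackPushforwardAdjunction f).isRightAdjoint
  have := opensMap_final f
  exact @asIso _ _ _ _ (SheafOfModules.pullbackObjUnitToUnit f.toRingCatSheafHom)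
    (SheafOfModules.instIsIsoPullbackObjUnitToUnitOfFinal _)

/-- The morphism `𝒪_U ⟶ M|_U` determined by a section of `M` over `U`. -/
def unitToRestrict {M : X.Modules} {U : X.Opens} (e : Γ(M, U)) :
    structureModule U.toScheme ⟶ M.restrict U.ι :=
  { val := PresheafOfModules.homMk (M₁ := (structureModule U.toScheme).val)
      (M₂ := (M.restrict U.ι).val)
      { app := fun V => AddCommGrpCat.ofHom
          (LinearMap.toAddMonoidHom
            (LinearMap.toSpanSingleton Γ(U.toScheme, V.unop) Γ(M.restrict U.ι, V.unop)
              (show Γ(M.restrict U.ι, V.unop) from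
                M.presheaf.map (homOfLE (Scheme.Opens.ι_image_le U V.unop)).op e)))
        naturality := fun V W i => by
          ext r
          refine Eq.trans ?_ (Scheme.Modules.map_smul (M.restrict U.ι) i.unop r _).symm
          exact congrArg (fun t : Γ(M.restrict U.ι, W.unop) =>
            (show Γ(U.toScheme, W.unop) from U.toScheme.presheaf.map i r) • t)
            (map_map_apply M (Scheme.Hom.image_mono _ i.unop.le)
              (Scheme.Opens.ι_image_le U V.unop) e).symm }
      (by
        intro V r m
        exact mul_smul (show Γ(U.toScheme, V.unop) from r) (show Γ(U.toScheme, V.unop) from m)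
          (show Γ(M.restrict U.ι, V.unop) from
            M.presheaf.map (homOfLE (Scheme.Opens.ι_image_le U V.unop)).op e)) }

theorem IsBasisOn.isIso_unitToRestrict {M : X.Modules} {U : X.Opens} {e : Γ(M, U)}
    (he : IsBasisOn M U e) : IsIso (unitToRestrict e) := by
  rw [Scheme.Modules.Hom.isIso_iff_isIso_app]
  intro V
  rw [ConcreteCategory.isIso_iff_bijective]
  exact (he (U.ι ''ᵁ V) (Scheme.Opens.ι_image_le U V)).comp
     (ConcreteCategory.bijective_of_isIso (U.ι.appIso V).inv)

theorem app_eq_smul {M : X.Modules} (φ : structureModule X ⟶ M) (W : X.Opens) (r : Γ(X, W)) :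
    φ.app W (show Γ(structureModule X, W) from r) = r • M.presheaf.map (homOfLE le_top).op
      (φ.app ⊤ (show Γ(structureModule X, ⊤) from (1 : Γ(X, ⊤)))) := by
  have h1 := appLinear_res φ (le_top : W ≤ ⊤) (show Γ(structureModule X, ⊤) from (1 : Γ(X, ⊤)))
  refine Eq.trans ?_ (congrArg (fun t => r • t) h1).symm
  refine Eq.trans ?_ (map_smul (appLinear φ W) r _)
  refine congrArg (φ.app W) ?_
  exact (mul_one r).symm.trans (congrArg (r * ·)
    (map_one (X.presheaf.map (homOfLE le_top).op).hom).symm)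

/-- The image of 1 is a basis. With `isIso_unitToRestrict` this translates between bases and
isomorphisms with the structure sheaf; pullback is handled through the latter. -/
theorem isFreeOn_of_iso {M : X.Modules} {U : X.Opens}
    (i : structureModule U.toScheme ≅ M.restrict U.ι) : IsFreeOn M U := by
  suffices H : IsFreeOn M (U.ι ''ᵁ ⊤) by rwa [Scheme.Opens.ι_image_top] at H
  refine ⟨i.hom.app ⊤ (show Γ(structureModule U.toScheme, ⊤) from (1 : Γ(U.toScheme, ⊤))), ?_⟩
  intro V h
  rw [Scheme.Opens.ι_image_top] at h
  obtain ⟨W, rfl⟩ : ∃ W : U.toScheme.Opens, V = U.ι ''ᵁ W := by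
    refine ⟨U.ι ⁻¹ᵁ V, ?_⟩
    rw [Scheme.Hom.image_preimage_eq_opensRange_inf, Scheme.Opens.opensRange_ι, inf_eq_right.2 h]
  have := (ConcreteCategory.bijective_of_isIso (i.hom.app W)).comp
     (ConcreteCategory.bijective_of_isIso (U.ι.appIso W).hom)
  refine (congrArg Function.Bijective (funext fun r => ?_)).mp this
  refine (app_eq_smul i.hom W _).trans ?_
  have h1 : (U.ι.appIso W).inv ((U.ι.appIso W).hom r) = r :=
    ConcreteCategory.congr_hom (U.ι.appIso W).hom_inv_id r
  exact congrArg (fun t : Γ(X, U.ι ''ᵁ W) => t • M.presheaf.map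
    (homOfLE (Scheme.Hom.image_mono U.ι (le_top : W ≤ ⊤))).op
      (show Γ(M, U.ι ''ᵁ ⊤) from i.hom.app ⊤ _)) h1

/-- The pullback of a module that is free of rank one. -/
theorem IsFreeOn.pullback (f : X ⟶ Y) {M : Y.Modules} {U : Y.Opens} (hM : IsFreeOn M U) :
    IsFreeOn ((Scheme.Modules.pullback f).obj M) (f ⁻¹ᵁ U) := by
  obtain ⟨e, he⟩ := hM
  have := he.isIso_unitToRestrict
  refine isFreeOn_of_iso ?_
  -- Restriction to an open set is pullback along its inclusion, so the claim follows from the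
  -- commutative square of `f` and `f ∣_ U`.
  refine (pullbackStructureModuleIso (f ∣_ U)).symm ≪≫
    (Scheme.Modules.pullback (f ∣_ U)).mapIso (asIso (unitToRestrict e) ≪≫
      (Scheme.Modules.restrictFunctorIsoPullback U.ι).app M) ≪≫
    (Scheme.Modules.pullbackComp _ _).app M ≪≫
    (Scheme.Modules.pullbackCongr (morphismRestrict_ι f U)).app M ≪≫
    (Scheme.Modules.pullbackComp _ _).symm.app M ≪≫
    ((Scheme.Modules.restrictFunctorIsoPullback _).symm.app _)

end Pullback

/-! ### Exactness of sheaf Hom out of a locally free module of rank one -/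

section Exactness
variable {X : Scheme.{u}}

/-- An epimorphism of `𝒪_X`-modules is surjective on sections locally. -/
theorem exists_local_lift_of_epi {M N : X.Modules} (g : M ⟶ N) [Epi g] {U : X.Opens}
    (s : Γ(N, U)) {x : X} (hx : x ∈ U) :
    ∃ (V : X.Opens) (h : V ≤ U) (t : Γ(M, V)), x ∈ V ∧
      g.app V t = N.presheaf.map (homOfLE h).op s := by
  let g' := (SheafOfModules.forget X.ringCatSheaf).map g
  -- The cokernel is taken among presheaves. Since `g` is epi, `N` maps to zero in its
  -- sheafification, so the class of `s` in `C` is locally zero and `s` is locally in the image.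
  let C := cokernel g'
  let η := PresheafOfModules.sheafificationHomEquiv (𝟙 X.ringCatSheaf.obj)
    (𝟙 ((PresheafOfModules.sheafification (𝟙 X.ringCatSheaf.obj)).obj C))
  let K : X.Modules := (PresheafOfModules.sheafification (𝟙 X.ringCatSheaf.obj)).obj C
  let φ : N ⟶ K := ⟨cokernel.π g' ≫ η⟩
  have hφ : φ = 0 := by
    rw [← cancel_epi g, comp_zero]
    apply (SheafOfModules.forget X.ringCatSheaf).map_injective
    have : g' ≫ cokernel.π g' ≫ η = 0 := by
      rw [← Category.assoc, cokernel.condition, zero_comp]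
    exact this
  have h0 : φ.app U s = 0 := by rw [hφ]; rfl
  have h := Presheaf.equalizerSieve_mem (Opens.grothendieckTopology X)
    (toSheafify (Opens.grothendieckTopology X) C.presheaf)
    (show C.presheaf.obj (op U) from (cokernel.π g').app (op U) s) 0 (h0.trans (map_zero _).symm)
  obtain ⟨V, i, hi, hxV⟩ := h x hx
  let S : ShortComplex (PresheafOfModules X.ringCatSheaf.obj) :=
    ShortComplex.mk g' (cokernel.π g') (cokernel.condition _)
  have hS : S.Exact := ShortComplex.exact_cokernel g'
  obtain ⟨t, ht⟩ := TopCat.Presheaf.sections_exact_of_exact (U := V)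
    (hS.map (PresheafOfModules.toPresheaf X.ringCatSheaf.obj))
    (s := N.presheaf.map i.op s) (by
      refine Eq.trans ?_ (hi.trans (map_zero _))
      exact PresheafOfModules.naturality_apply (cokernel.π g') i.op s)
  exact ⟨V, i.le, t, hxV, ht⟩

theorem epi_of_exists_local_lift {M N : X.Modules} (g : M ⟶ N)
    (hg : ∀ (U : X.Opens) (s : Γ(N, U)) (x : X), x ∈ U → ∃ (V : X.Opens) (h : V ≤ U) (t : Γ(M, V)),
      x ∈ V ∧ g.app V t = N.presheaf.map (homOfLE h).op s) : Epi g := by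
  let F : X.Modules ⥤ _ := SheafOfModules.toSheaf X.ringCatSheaf
  have : F.Faithful := inferInstanceAs (SheafOfModules.toSheaf X.ringCatSheaf).Faithful
  refine F.epi_of_epi_map ((TopCat.Sheaf.isLocallySurjective_iff_epi
    (X := X.toPresheafedSpace.carrier) (F.map g)).1 ?_)
  refine (TopCat.Presheaf.isLocallySurjective_iff _).2 fun U s x hx => ?_
  obtain ⟨V, h, t, hxV, ht⟩ := hg U s x hx
  exact ⟨V, h, ⟨t, ht⟩, hxV⟩

theorem app_injective_of_mono {M N : X.Modules} (f : M ⟶ N) [Mono f] (U : X.Opens) :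
    Function.Injective (f.app U) := by
  have : Mono ((Scheme.Modules.toPresheaf X).map f) := inferInstance
  have : Mono (((Scheme.Modules.toPresheaf X).map f).app (op U)) := inferInstance
  exact (AddCommGrpCat.mono_iff_injective _).1 this

/-- The passage to presheaves is left exact, so kernels are computed on sections, with no shrinking
of `U`. -/
theorem exists_kernel_ι_app_eq {M N : X.Modules} (g : M ⟶ N) {U : X.Opens} (s : Γ(M, U))
    (hs : g.app U s = 0) : ∃ t : Γ(kernel g, U), (kernel.ι g).app U t = s := by
  let S : ShortComplex X.Modules := ShortComplex.mk (kernel.ι g) g (kernel.condition g)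
  have hS : S.Exact := ShortComplex.exact_kernel g
  have : (Scheme.Modules.toPresheaf X).Additive := ⟨rfl⟩
  have := ((Functor.preservesFiniteLimits_tfae (Scheme.Modules.toPresheaf X)).out 1 3 rfl rfl).mpr
    inferInstance S ⟨hS, inferInstanceAs (Mono (kernel.ι g))⟩
  exact TopCat.Presheaf.sections_exact_of_exact this.1 hs

/-- A sequence of `𝒪_X`-modules is exact iff sections killed by the second map come locally from
the first module. -/
theorem exact_iff_exists_local_lift (S : ShortComplex X.Modules) :
    S.Exact ↔ ∀ (U : X.Opens) (s : Γ(S.X₂, U)), S.g.app U s = 0 → ∀ x ∈ U,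
      ∃ (V : X.Opens) (h : V ≤ U) (t : Γ(S.X₁, V)), x ∈ V ∧
        S.f.app V t = S.X₂.presheaf.map (homOfLE h).op s := by
  rw [S.exact_iff_epi_kernel_lift]
  constructor
  · intro _ U s hs x hx
    obtain ⟨s, rfl⟩ := exists_kernel_ι_app_eq S.g s hs
    obtain ⟨V, h, t, hxV, ht⟩ := exists_local_lift_of_epi (kernel.lift S.g S.f S.zero) s hx
    refine ⟨V, h, t, hxV, ?_⟩
    have h1 : S.f.app V t = (kernel.ι S.g).app V ((kernel.lift S.g S.f S.zero).app V t) :=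
      congrArg (fun φ : S.X₁ ⟶ S.X₂ => φ.app V t) (kernel.lift_ι S.g S.f S.zero).symm
    rw [h1, ht]
    exact (appLinear_res (kernel.ι S.g) h s).symm
  · intro H
    refine epi_of_exists_local_lift _ fun U s x hx => ?_
    obtain ⟨V, h, t, hxV, ht⟩ := H U ((kernel.ι S.g).app U s)
      (congrArg (fun φ : kernel S.g ⟶ S.X₃ => φ.app U s) (kernel.condition S.g)) x hx
    refine ⟨V, h, t, hxV, app_injective_of_mono (kernel.ι S.g) V ?_⟩
    refine Eq.trans ?_ (ht.trans (appLinear_res (kernel.ι S.g) h s))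
    exact congrArg (fun φ : S.X₁ ⟶ S.X₂ => φ.app V t) (kernel.lift_ι S.g S.f S.zero)

/-- `ℋom(A, -)` is exact if `A` is locally free of rank one. -/
theorem preservesHomology_sheafHom (A : X.Modules)
    (hA : ∀ x : X, ∃ U : X.Opens, x ∈ U ∧ IsFreeOn A U) : (sheafHom A).PreservesHomology := by
  refine ((Functor.exact_tfae (sheafHom A)).out 1 2 rfl rfl).1 fun S hS => ?_
  rw [exact_iff_exists_local_lift] at hS ⊢
  intro U φ hφ x hx
  obtain ⟨W, hxW, hW⟩ := hA x
  obtain ⟨e, he⟩ := hW.mono (inf_le_right : U ⊓ W ≤ W)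
  have hle : U ⊓ W ≤ U := inf_le_left
  let φ' : homSections A S.X₂ U := φ
  let ψ := homSectionsRes hle φ'
  -- Evaluation at the basis `e` turns local homomorphisms into sections, to which the exactness of
  -- `S` applies.
  have h0 : S.g.app (U ⊓ W) (ψ.1 ⟨_, le_rfl⟩ e) = 0 := by
    have h1 : (homSectionsPost A S.g U φ').1 ⟨U ⊓ W, hle⟩ e = 0 := by
      have : homSectionsPost A S.g U φ' = 0 := hφ
      rw [this]; rfl
    exact h1
  obtain ⟨V, h, t, hxV, ht⟩ := hS _ _ h0 x ⟨hx, hxW⟩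
  obtain ⟨τ, hτ⟩ := ((he.restrict h).eval_bijective S.X₁).2 t
  refine ⟨V, h.trans hle, τ, hxV, ((he.restrict h).eval_bijective S.X₂).1 ?_⟩
  refine (congrArg (S.f.app V) hτ).trans (ht.trans ?_)
  exact (eval_restrict S.X₂ h ψ e).symm

end Exactness

/-! ### Derived functors of exact functors -/

section ExtSheaf

/-- The derived functor is computed by applying `G` to an injective resolution, and an exact `G`
commutes with the homology of that complex. -/
theorem nonempty_homology_rightDerivedFunctorPlus_iso {C D : Type*} [Category* C] [Category* D]
    [Abelian C] [Abelian D] [HasDerivedCategory C] [HasDerivedCategory D] [EnoughInjectives C]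
    (G : C ⥤ D) [G.Additive] [G.PreservesHomology] (K : DerivedCategory.Plus C) (p : ℤ) :
    Nonempty ((DerivedCategory.Plus.homologyFunctor D p).obj (G.rightDerivedFunctorPlus.obj K) ≅
      G.obj ((DerivedCategory.Plus.homologyFunctor C p).obj K)) := by
  obtain ⟨n, hn⟩ : ∃ n, K.IsGE n := by
    obtain ⟨n, hn⟩ := K.property
    exact ⟨n, (DerivedCategory.Plus.isGE_ι_obj_iff K n).1 hn⟩
  obtain ⟨L, -, ⟨e⟩⟩ := DerivedCategory.Plus.exists_injective_nonempty_iso K n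
  let I := (InjectiveObject.ι C).mapCochainComplexPlus.obj L
  let u := asIso (G.rightDerivedFunctorPlusUnit.app ((HomotopyCategory.Plus.quotient C).obj I))
  let T : CochainComplex D ℤ := (G.mapHomologicalComplex _).obj I.obj
  have e1 : (DerivedCategory.Plus.homologyFunctor D p).obj (G.rightDerivedFunctorPlus.obj K) ≅
      (DerivedCategory.homologyFunctor D p).obj (DerivedCategory.Q.obj T) :=
    (DerivedCategory.Plus.homologyFunctor D p).mapIso
      ((G.rightDerivedFunctorPlus.mapIso e).symm ≪≫ u.symm)
  have e2 : (DerivedCategory.homologyFunctor D p).obj (DerivedCategory.Q.obj T) ≅ T.homology p :=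
    (DerivedCategory.homologyFunctorFactors D p).app T
  have e3 : T.homology p ≅ G.obj (I.obj.homology p) :=
    (I.obj.sc p).mapHomologyIso G
  have e4 : (DerivedCategory.homologyFunctor C p).obj (DerivedCategory.Q.obj I.obj) ≅
      I.obj.homology p := (DerivedCategory.homologyFunctorFactors C p).app I.obj
  have e5 : (DerivedCategory.homologyFunctor C p).obj (DerivedCategory.Q.obj I.obj) ≅
      (DerivedCategory.Plus.homologyFunctor C p).obj K :=
    (DerivedCategory.Plus.homologyFunctor C p).mapIso e
  exact ⟨e1 ≪≫ e2 ≪≫ e3 ≪≫ G.mapIso (e4.symm ≪≫ e5)⟩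

end ExtSheaf

/-! ### Local generators of the twisting sheaves -/

section TwistBasis
variable {A : Type} [CommRing A] [Algebra ℂ A] {𝒜 : ℕ → Submodule ℂ A} [GradedAlgebra 𝒜]

theorem isUnit_algebraMap_locAt {x : ProjectiveSpectrum 𝒜} {b : A}
    (hb : b ∉ x.asHomogeneousIdeal) : IsUnit (algebraMap A (LocAt 𝒜 x) b) :=
  IsLocalization.map_units (LocAt 𝒜 x) (⟨b, hb⟩ : x.asHomogeneousIdeal.toIdeal.primeCompl)

theorem pow_notMem {x : ProjectiveSpectrum 𝒜} {b : A} (hb : b ∉ x.asHomogeneousIdeal) (k : ℕ) :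
    b ^ k ∉ x.asHomogeneousIdeal :=
  fun h => hb ((ProjectiveSpectrum.isPrime x).mem_of_pow_mem _ h)

theorem mul_notMem {x : ProjectiveSpectrum 𝒜} {a b : A} (ha : a ∉ x.asHomogeneousIdeal)
    (hb : b ∉ x.asHomogeneousIdeal) : a * b ∉ x.asHomogeneousIdeal :=
  fun h => ((ProjectiveSpectrum.isPrime x).mem_or_mem h).elim ha hb

theorem eq_zero_of_sectionValue {U : (Proj 𝒜).Opens} (r : Γ(Proj 𝒜, U))
    (h : ∀ x : U, sectionValue x r = 0) : r = 0 := by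
  refine Subtype.ext (funext fun x => ?_)
  exact HomogeneousLocalization.val_injective _ ((h x).trans HomogeneousLocalization.val_zero.symm)

/-- A fraction of homogeneous elements of the same degree is a function where the denominator
does not vanish. -/
theorem exists_section_eq_fraction (W : (Proj 𝒜).Opens) {i : ℕ} (a b : 𝒜 i)
    (hb : ∀ y : W, (b : A) ∉ ProjectiveSpectrum.asHomogeneousIdeal (𝒜 := 𝒜) y.1) :
    ∃ r : Γ(Proj 𝒜, W), ∀ y : W, algebraMap A (LocAt 𝒜 y.1) b * sectionValue y r =
      algebraMap A (LocAt 𝒜 y.1) a := by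
  let r : (ProjectiveSpectrum.Proj.structureSheaf 𝒜).1.obj (op W) :=
    ⟨fun y => HomogeneousLocalization.mk ⟨i, a, b, hb y⟩,
      fun y => ⟨W, y.2, 𝟙 _, i, a, b, fun z => hb z, fun z => rfl⟩⟩
  refine ⟨r, fun y => ?_⟩
  refine (congrArg _ (HomogeneousLocalization.val_mk _)).trans ?_
  rw [Localization.mk_eq_mk', mul_comm]
  exact IsLocalization.mk'_spec (LocAt 𝒜 y.1) (a : A) ⟨(b : A), hb y⟩

/-- The sheaf `𝒪(k)` is free of rank one where an element of degree one does not vanish. -/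
theorem isFreeOn_twist_of_notMem {g : A} (hg : g ∈ 𝒜 1) (k : ℤ) (U : (Proj 𝒜).Opens)
    (hU : ∀ y : U, g ∉ ProjectiveSpectrum.asHomogeneousIdeal (𝒜 := 𝒜) y.1) :
    IsFreeOn (twist 𝒜 k) U := by
  -- The generator is g^k, written as the fraction g^q / g^p to allow negative `k`.
  obtain ⟨p, q, hk⟩ : ∃ p q : ℕ, k = q - p := ⟨(-k).toNat, k.toNat, by omega⟩
  have hgk : ∀ k : ℕ, g ^ k ∈ 𝒜 k := fun k => by
    simpa using SetLike.pow_mem_graded k hg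
  choose e he using fun y : U => show ∃ t : LocAt 𝒜 y.1,
      algebraMap A (LocAt 𝒜 y.1) (g ^ p) * t = algebraMap A (LocAt 𝒜 y.1) (g ^ q) from
    (isUnit_algebraMap_locAt (pow_notMem (hU y) p)).dvd.imp fun _ ht => ht.symm
  have heu : ∀ y, IsUnit (e y) := fun y => by
    have := isUnit_algebraMap_locAt (pow_notMem (hU y) q)
    rw [← he y] at this
    exact isUnit_of_mul_isUnit_right this
  let E : twistSections 𝒜 k U :=
    ⟨e, fun x => ⟨U, x.2, q, p, ⟨_, hgk q⟩, ⟨_, hgk p⟩, by omega,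
      fun y _ => ⟨pow_notMem (hU y) p, he y⟩⟩⟩
  refine ⟨E, isBasisOn_of_locally _ ?_ ?_⟩
  · intro V h r hr
    refine eq_zero_of_sectionValue r fun x => ?_
    have : sectionValue x r * e ⟨x.1, h x.2⟩ = 0 := congrFun (congrArg Subtype.val hr) x
    exact (IsUnit.mul_left_eq_zero (heu ⟨x.1, h x.2⟩)).1 this
  · intro V h m x hx
    let m' : twistSections 𝒜 k V := m
    obtain ⟨W, hxW, i, j, a, b, hij, hab⟩ := m'.2 ⟨x, hx⟩
    have hij' : i + p = j + q := by omega
    have hWb : ∀ y : (W ⊓ V : Opens (ProjectiveSpectrum.top 𝒜)),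
        (b : A) * g ^ q ∉ ProjectiveSpectrum.asHomogeneousIdeal (𝒜 := 𝒜) y.1 := fun y =>
      mul_notMem (hab ⟨y.1, y.2.2⟩ y.2.1).1 (pow_notMem (hU ⟨y.1, h y.2.2⟩) q)
    -- The coordinate of a / b in the basis g^q / g^p is a g^p / (b g^q), of degree zero because i +
    -- p = j + q.
    obtain ⟨r, hr⟩ := exists_section_eq_fraction (W ⊓ V)
      ⟨a * g ^ p, hij' ▸ SetLike.mul_mem_graded a.2 (hgk p)⟩
      ⟨b * g ^ q, SetLike.mul_mem_graded b.2 (hgk q)⟩ hWb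
    refine ⟨W ⊓ V, inf_le_right, inf_le_right.trans h, r, ⟨hxW, hx⟩, ?_⟩
    refine Subtype.ext (funext fun y => ?_)
    change sectionValue y r * e ⟨y.1, h y.2.2⟩ = m'.1 ⟨y.1, y.2.2⟩
    obtain ⟨hb, hbm⟩ := hab ⟨y.1, y.2.2⟩ y.2.1
    have hu := isUnit_algebraMap_locAt (mul_notMem hb (pow_notMem (hU ⟨y.1, h y.2.2⟩) p))
    refine hu.mul_left_cancel ?_
    have h1 := hr y
    have h2 := he ⟨y.1, h y.2.2⟩
    simp only [map_mul] at h1 h2 hbm ⊢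
    linear_combination (algebraMap A (LocAt 𝒜 y.1) b * sectionValue y r) * h2 + h1 -
      algebraMap A (LocAt 𝒜 y.1) (g ^ p) * hbm

theorem isFreeOn_twist {g : A} (hg : g ∈ 𝒜 1) (k : ℤ) :
    IsFreeOn (twist 𝒜 k) (Proj.basicOpen 𝒜 g) :=
  isFreeOn_twist_of_notMem hg k _ fun y => y.2

end TwistBasis

/-! ### Homogeneous relations and elimination of one equation -/

section Relations
open MvPolynomial

/-- If a domain has transcendence degree at most `N + 1`, then `N + 1` of its elements satisfy a
nontrivial polynomial relation modulo any nonzero element. -/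
theorem exists_dvd_aeval_of_trdeg_le {S : Type} [CommRing S] [IsDomain S] [Algebra ℂ S] {N : ℕ}
    (hS : Algebra.trdeg ℂ S ≤ (N + 1 : ℕ)) {f : S} (hf : f ≠ 0) (g : Fin (N + 1) → S) :
    ∃ R : MvPolynomial (Fin (N + 1)) ℂ, R ≠ 0 ∧ f ∣ aeval g R := by
  by_cases hg : AlgebraicIndependent ℂ g
  · have hfa : IsAlgebraic (Algebra.adjoin ℂ (Set.range g)) f := by
      by_contra h
      have h1 := ((hg.option_iff_transcendental f).2 h).cardinalMk_le_trdeg.trans hS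
      rw [Cardinal.mk_fintype, Fintype.card_option, Fintype.card_fin] at h1
      exact absurd (Nat.cast_le.1 h1) (by omega)
    obtain ⟨⟨r, hr⟩, hr0, hd⟩ := hfa.exists_nonzero_dvd (mem_nonZeroDivisors_of_ne_zero hf)
    rw [Algebra.adjoin_range_eq_range_aeval] at hr
    obtain ⟨R, rfl⟩ := hr
    refine ⟨R, ?_, hd⟩
    rintro rfl
    exact hr0 (Subtype.ext (map_zero _))
  · rw [algebraicIndependent_iff] at hg
    push Not at hg
    obtain ⟨R, h, h0⟩ := hg
    exact ⟨R, h0, h ▸ dvd_zero _⟩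

/-- A polynomial relation between elements of degree one yields a homogeneous one. -/
theorem exists_isHomogeneous_aeval_eq_zero {B : Type} [CommRing B] [Algebra ℂ B]
    (ℬ : ℕ → Submodule ℂ B) [GradedAlgebra ℬ] {σ : Type} {g : σ → B} (hg : ∀ i, g i ∈ ℬ 1)
    {R : MvPolynomial σ ℂ} (hR : R ≠ 0) (h : aeval g R = 0) :
    ∃ (d : ℕ) (Q : MvPolynomial σ ℂ), Q ≠ 0 ∧ Q.IsHomogeneous d ∧ aeval g Q = 0 := by
  have hmem : ∀ (d : ℕ) (Q : MvPolynomial σ ℂ), Q.IsHomogeneous d → aeval g Q ∈ ℬ d := by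
    intro d Q hQ
    rw [aeval_def, eval₂_eq]
    refine sum_mem fun m hm => ?_
    rw [← Algebra.smul_def]
    refine Submodule.smul_mem _ _ ?_
    have h1 := SetLike.prod_pow_mem_graded ℬ (fun _ => 1) g m (F := m.support) fun i _ => hg i
    have h2 : m.support.sum (fun k => m k • (1 : ℕ)) = d := by
      have := hQ (mem_support_iff.1 hm)
      rw [← this]
      simp [Finsupp.weight_apply, Finsupp.sum]
    rwa [h2] at h1
  obtain ⟨d, hd⟩ : ∃ d, homogeneousComponent d R ≠ 0 := by
    by_contra! h0
    exact hR (by rw [← sum_homogeneousComponent R, Finset.sum_eq_zero fun i _ => h0 i])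
  refine ⟨d, _, hd, homogeneousComponent_isHomogeneous d R, ?_⟩
  -- The components of `R` take values in different degrees of `B`, so each of them vanishes at `g`.
  have h1 : ∑ i ∈ Finset.range (R.totalDegree + 1), aeval g (homogeneousComponent i R) = 0 := by
    rw [← map_sum, sum_homogeneousComponent, h]
  have h2 := congrArg (GradedRing.proj ℬ d) h1
  rw [map_sum, map_zero, Finset.sum_eq_single d] at h2
  · rwa [GradedRing.proj_apply, DirectSum.decompose_of_mem_same _
      (hmem d _ (homogeneousComponent_isHomogeneous d R))] at h2
  · intro i _ hi
    rw [GradedRing.proj_apply, DirectSum.decompose_of_mem_ne _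
      (hmem i _ (homogeneousComponent_isHomogeneous i R)) hi]
  · intro hd'
    rw [homogeneousComponent_eq_zero _ _ (by simpa using hd'), map_zero, map_zero]

/-- Elements that satisfy a homogeneous relation have the same common zeros as one linear
combination less. -/
theorem exists_forall_mem_of_isHomogeneous {B : Type} [CommRing B] [Algebra ℂ B] {N d : ℕ}
    {g : Fin (N + 1) → B} {R : MvPolynomial (Fin (N + 1)) ℂ} (hR : R ≠ 0)
    (hd : R.IsHomogeneous d) (h : aeval g R = 0) :
    ∃ t : Fin N → ℂ, ∀ 𝔭 : Ideal B, 𝔭.IsPrime → (∀ i, g i.succ - t i • g 0 ∈ 𝔭) →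
      ∀ i, g i ∈ 𝔭 := by
  -- `c` is the centre of projection, off the zero set of `R`; the factor `X 0` makes c 0
  -- invertible.
  obtain ⟨c, hc⟩ : ∃ c : Fin (N + 1) → ℂ, eval c (R * X 0) ≠ 0 := by
    by_contra! h0
    exact mul_ne_zero hR (X_ne_zero 0) (MvPolynomial.funext fun c => by rw [h0, map_zero])
  rw [map_mul, eval_X] at hc
  obtain ⟨hRc, hc0⟩ := mul_ne_zero_iff.1 hc
  refine ⟨fun i => c i.succ / c 0, fun 𝔭 h𝔭 hmem => ?_⟩
  have key : ∀ i, Ideal.Quotient.mkₐ ℂ 𝔭 (g i) =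
      (c i / c 0) • Ideal.Quotient.mkₐ ℂ 𝔭 (g 0) := by
    intro i
    refine Fin.cases ?_ (fun i => ?_) i
    · rw [div_self hc0, one_smul]
    · rw [← map_smul]
      exact Ideal.Quotient.eq.2 (hmem i)
  have h0 : g 0 ∈ 𝔭 := by
    have h1 : aeval (fun i => Ideal.Quotient.mkₐ ℂ 𝔭 (g i)) R = 0 := by
      have := congrArg (Ideal.Quotient.mkₐ ℂ 𝔭) h
      rw [map_zero, ← AlgHom.comp_apply, comp_aeval] at this
      exact this
    set γ := Ideal.Quotient.mkₐ ℂ 𝔭 (g 0)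
    -- Modulo `𝔭` the `g i` are proportional to the `c i`, so homogeneity gives R(g) = R(c) (γ / c
    -- 0)^d. As R(c) ≠ 0, this forces γ = 0.
    have h2 : aeval (fun i => Ideal.Quotient.mkₐ ℂ 𝔭 (g i)) R =
        (eval c R) • ((c 0)⁻¹ • γ) ^ d := by
      rw [aeval_def, eval₂_eq, eval_eq, Finset.sum_smul]
      refine Finset.sum_congr rfl fun m hm => ?_
      have hmd : ∑ i ∈ m.support, m i = d := by
        have := hd (mem_support_iff.1 hm)
        rw [← this]
        simp [Finsupp.weight_apply, Finsupp.sum]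
      rw [← Algebra.smul_def, mul_smul, ← hmd, ← Finset.prod_pow_eq_pow_sum]
      congr 1
      rw [Algebra.smul_def, map_prod, ← Finset.prod_mul_distrib]
      refine Finset.prod_congr rfl fun i _ => ?_
      rw [key, map_pow, ← mul_pow, ← Algebra.smul_def, smul_smul, div_eq_mul_inv]
    rw [h1, eq_comm, smul_eq_zero_iff_right hRc, smul_pow,
      smul_eq_zero_iff_right (pow_ne_zero _ (inv_ne_zero hc0)), ← map_pow] at h2
    exact h𝔭.mem_of_pow_mem d (Ideal.Quotient.eq_zero_iff_mem.1 h2)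
  intro i
  have := key i
  rw [show Ideal.Quotient.mkₐ ℂ 𝔭 (g 0) = 0 from Ideal.Quotient.eq_zero_iff_mem.2 h0,
    smul_zero] at this
  exact Ideal.Quotient.eq_zero_iff_mem.1 this

end Relations

/-! ### Transcendence degree of the ambient Laurent algebra -/

section LaurentTrdeg
open AddMonoidAlgebra

/-- The ring of polynomials in `t` over the ring of Laurent polynomials in `n` variables has
transcendence degree at most `n + 1`. -/
theorem trdeg_laurent_le (n : ℕ) :
    Algebra.trdeg ℂ (AddMonoidAlgebra ℂ ((Fin n → ℤ) × ℕ)) ≤ (n + 1 : ℕ) := by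
  classical
  let L := AddMonoidAlgebra ℂ ((Fin n → ℤ) × ℕ)
  let x : Option (Fin n) → L := fun o =>
    o.elim (single (0, 1) 1) fun i => single (Pi.single i 1, 0) 1
  let K := Algebra.adjoin ℂ (Set.range x)
  have hx : ∀ o, IsAlgebraic K (x o) := fun o =>
    isAlgebraic_algebraMap (⟨x o, Algebra.subset_adjoin ⟨o, rfl⟩⟩ : K)
  have hinv : ∀ i : Fin n, IsAlgebraic K (single (Pi.single i (-1), 0) 1 : L) := by
    intro i
    have : x (some i) * single (Pi.single i (-1), 0) 1 = 1 := by
      refine (single_mul_single _ _ _ _).trans ?_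
      rw [Prod.mk_add_mk, ← Pi.single_add, add_neg_cancel, Pi.single_zero, add_zero, one_mul]
      rfl
    refine IsAlgebraic.of_mul (mem_nonZeroDivisors_of_ne_zero (left_ne_zero_of_mul_eq_one this))
      (hx (some i)) ?_
    rw [this]
    exact isAlgebraic_one
  -- The exponents of monomials algebraic over `K` form a submonoid, so it suffices to treat the
  -- variables and their inverses.
  let P : AddSubmonoid ((Fin n → ℤ) × ℕ) :=
    { carrier := {m | IsAlgebraic K (single m 1 : L)}
      zero_mem' := isAlgebraic_one
      add_mem' := fun {a b} ha hb => by
        have := IsAlgebraic.mul ha hb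
        rwa [single_mul_single, one_mul] at this }
  have hP : ∀ m, m ∈ P := by
    rintro ⟨m, k⟩
    have h1 : ((m, k) : (Fin n → ℤ) × ℕ) =
        ∑ i, AddMonoidHom.inl _ ℕ (Pi.single i (m i)) + k • (0, 1) := by
      rw [← map_sum, Finset.univ_sum_single]
      simp
    rw [h1]
    refine add_mem (sum_mem fun i _ => ?_) (nsmul_mem (show (0, 1) ∈ P from hx none) k)
    rcases Int.eq_nat_or_neg (m i) with ⟨l, hl | hl⟩
    · have : AddMonoidHom.inl _ ℕ (Pi.single i (m i)) =
          l • ((Pi.single i 1, 0) : (Fin n → ℤ) × ℕ) := by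
        simp [hl, ← Pi.single_smul]
      rw [this]
      exact nsmul_mem (show (Pi.single i 1, 0) ∈ P from hx (some i)) l
    · have : AddMonoidHom.inl _ ℕ (Pi.single i (m i)) =
          l • ((Pi.single i (-1), 0) : (Fin n → ℤ) × ℕ) := by
        simp [hl, ← Pi.single_smul]
      rw [this]
      exact nsmul_mem (show (Pi.single i (-1), 0) ∈ P from hinv i) l
  have : Algebra.IsAlgebraic K L := ⟨fun a => by
    induction a using AddMonoidAlgebra.induction_linear with
    | zero => exact isAlgebraic_zero
    | add a b ha hb => exact ha.add hb
    | single m r =>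
      have : (single m r : L) = algebraMap ℂ K r • single m 1 := by
        rw [algebraMap_smul, smul_single, smul_eq_mul, mul_one]
      rw [this]
      exact IsAlgebraic.smul (show IsAlgebraic K (single m 1 : L) from hP m) _⟩
  -- As everything is algebraic over `K`, a transcendence basis can be chosen among its n + 1
  -- generators.
  obtain ⟨t, ht, hb⟩ := exists_isTranscendenceBasis_subset (R := ℂ) (Set.range x)
  rw [← hb.cardinalMk_eq_trdeg]
  refine (Cardinal.mk_le_mk_of_subset ht).trans (Cardinal.mk_range_le.trans ?_)
  simp

end LaurentTrdeg

/-! ### Covering the hypersurface by n principal open sets -/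

section ToricCover
open AddMonoidAlgebra Pointwise
namespace LatticePolytope
variable {n : ℕ} (Δ : LatticePolytope n)

/-- This makes `polytopeAlgebra` a domain. -/
instance twoUniqueSums_coneMonoid : TwoUniqueSums Δ.coneMonoid :=
  TwoUniqueSums.of_injective_addHom Δ.coneMonoid.subtype.toAddHom Subtype.val_injective
    inferInstance

theorem trdeg_polytopeAlgebra_le : Algebra.trdeg ℂ Δ.polytopeAlgebra ≤ (n + 1 : ℕ) :=
  (trdeg_le_of_injective
    (mapDomainAlgHom ℂ ℂ Δ.coneMonoid.subtype)
    (mapDomain_injective Subtype.val_injective)).trans (trdeg_laurent_le n)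

theorem mem_smul_carrier_iff {r : ℝ} (hr : 0 ≤ r) (y : Fin n → ℝ) :
    y ∈ r • Δ.carrier ↔ ∃ w : (Fin n → ℤ) → ℝ, (∀ v ∈ Δ.points, 0 ≤ w v) ∧
      ∑ v ∈ Δ.points, w v = r ∧ ∑ v ∈ Δ.points, w v • toReal v = y := by
  classical
  have hinj : Function.Injective (toReal (n := n)) := fun a b h => by
    ext i
    exact Int.cast_injective (congrFun h i)
  have hcar : Δ.carrier = convexHull ℝ ((Δ.points.image toReal : Finset (Fin n → ℝ)) : Set _) := by
    rw [carrier, Finset.coe_image]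
  constructor
  · rintro ⟨z, hz, rfl⟩
    rw [hcar, Finset.mem_convexHull'] at hz
    obtain ⟨w, hw0, hw1, hwz⟩ := hz
    rw [Finset.sum_image hinj.injOn] at hw1 hwz
    refine ⟨fun v => r * w (toReal v), fun v hv =>
      mul_nonneg hr (hw0 _ (Finset.mem_image_of_mem _ hv)), ?_, ?_⟩
    · rw [← Finset.mul_sum, hw1, mul_one]
    · simp only [mul_smul]
      rw [← Finset.smul_sum, hwz]
  · rintro ⟨w, hw0, hw1, rfl⟩
    rcases hr.eq_or_lt with rfl | hr
    · have : ∀ v ∈ Δ.points, w v = 0 := (Finset.sum_eq_zero_iff_of_nonneg hw0).1 hw1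
      rw [Set.zero_smul_set Δ.carrier_nonempty, Finset.sum_eq_zero fun v hv => by
        rw [this v hv, zero_smul]]
      exact Set.mem_singleton _
    · refine ⟨∑ v ∈ Δ.points, (r⁻¹ * w v) • toReal v, ?_, ?_⟩
      · refine (convex_convexHull ℝ _).sum_mem (fun v hv => mul_nonneg (inv_nonneg.2 hr.le)
          (hw0 v hv)) ?_ fun v hv => subset_convexHull ℝ _ ⟨v, hv, rfl⟩
        rw [← Finset.mul_sum, hw1, inv_mul_cancel₀ hr.ne']
      · simp only [Finset.smul_sum, smul_smul, mul_inv_cancel_left₀ hr.ne']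

theorem mem_coneMonoid_of_mem_points {v : Fin n → ℤ} (hv : v ∈ Δ.points) :
    (v, 1) ∈ Δ.coneMonoid := by
  change toReal v ∈ ((1 : ℕ) : ℝ) • Δ.carrier
  rw [Nat.cast_one, one_smul]
  exact subset_convexHull ℝ _ ⟨v, hv, rfl⟩

/-- A multiple of a nonzero element of the cone over `Δ` is divisible by one of the lattice points
that span `Δ`. -/
theorem exists_nsmul_eq_add (x : Δ.coneMonoid) (hx : 0 < Δ.degree x) :
    ∃ (v : Fin n → ℤ) (hv : v ∈ Δ.points) (N : ℕ) (y : Δ.coneMonoid),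
      N • x = ⟨(v, 1), Δ.mem_coneMonoid_of_mem_points hv⟩ + y := by
  classical
  obtain ⟨⟨m, k⟩, hm⟩ := x
  change 0 < k at hx
  obtain ⟨w, hw0, hw1, hwm⟩ := (Δ.mem_smul_carrier_iff (Nat.cast_nonneg k) _).1 hm
  obtain ⟨v, hv, hwv⟩ : ∃ v ∈ Δ.points, 0 < w v := by
    by_contra! h
    have : (k : ℝ) ≤ 0 := hw1 ▸ Finset.sum_nonpos h
    exact absurd (Nat.cast_pos.2 hx) (not_lt.2 this)
  -- For this `N` the weight of `v` in N • x is at least 1, so subtracting (v, 1) stays inside the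
  -- cone.
  obtain ⟨N, hN⟩ := exists_nat_ge (1 / w v)
  rw [div_le_iff₀ hwv] at hN
  have hN0 : 0 < N := by
    rcases Nat.eq_zero_or_pos N with rfl | h
    · norm_num at hN
    · exact h
  have hNk : 1 ≤ N * k := Nat.mul_pos hN0 hx
  refine ⟨v, hv, N, ⟨(N • m - v, N * k - 1), ?_⟩, ?_⟩
  · refine (Δ.mem_smul_carrier_iff (Nat.cast_nonneg _) _).2
      ⟨fun u => N * w u - if u = v then 1 else 0, fun u hu => ?_, ?_, ?_⟩
    · by_cases h : u = v
      · simp only [h, if_true]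
        linarith
      · simp only [h, if_false, sub_zero]
        exact mul_nonneg (Nat.cast_nonneg _) (hw0 u hu)
    · rw [Finset.sum_sub_distrib, ← Finset.mul_sum, hw1, Finset.sum_ite_eq', if_pos hv,
        Nat.cast_sub hNk]
      push_cast
      ring
    · simp only [sub_smul, mul_smul, ite_smul, one_smul, zero_smul]
      rw [Finset.sum_sub_distrib, ← Finset.smul_sum, hwm, Finset.sum_ite_eq', if_pos hv]
      ext i
      simp [toReal]
  · apply Subtype.ext
    change N • ((m, k) : (Fin n → ℤ) × ℕ) = (v, 1) + (N • m - v, N * k - 1)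
    ext1
    · simp
    · simp only [Prod.smul_mk, smul_eq_mul, Prod.mk_add_mk]
      omega

/-- The monomial `χ^v t` of a lattice point that spans `Δ`. -/
def vertexMonomial (v : Δ.points) : Δ.grading 1 :=
  ⟨single ⟨(v.1, 1), Δ.mem_coneMonoid_of_mem_points v.2⟩ 1, single_mem_gradeBy Δ.degree _ 1⟩

/-- The monomials `χ^v t` have no common zeros on `Proj S_Δ`. -/
theorem mem_of_forall_vertexMonomial_mem {𝔭 : Ideal Δ.polytopeAlgebra} (h𝔭 : 𝔭.IsPrime)
    (h : ∀ v, (Δ.vertexMonomial v : Δ.polytopeAlgebra) ∈ 𝔭) {k : ℕ} (hk : 0 < k)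
    {a : Δ.polytopeAlgebra} (ha : a ∈ Δ.grading k) : a ∈ 𝔭 := by
  have hs : ∀ x : Δ.coneMonoid, 0 < Δ.degree x → single x 1 ∈ 𝔭 := by
    intro x hx
    obtain ⟨v, hv, N, y, hy⟩ := Δ.exists_nsmul_eq_add x hx
    refine h𝔭.mem_of_pow_mem N ?_
    rw [single_pow, one_pow, hy, ← one_mul (1 : ℂ), ← single_mul_single]
    exact 𝔭.mul_mem_right _ (h ⟨v, hv⟩)
  rw [← sum_coeff_single a]
  refine sum_mem fun x hx => ?_
  have hx' : Δ.degree x = k := ha x hx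
  change single x (a.coeff x) ∈ 𝔭
  have : single x (a.coeff x) = single 0 (a.coeff x) * single x (1 : ℂ) := by
    rw [single_mul_single, zero_add, mul_one]
  rw [this]
  exact 𝔭.mul_mem_left _ (hs x (hx'.symm ▸ hk))

variable (f : Δ.grading 1)

/-- The degree one elements `g` have no common zeros on the hypersurface `f = 0`. -/
def CoversHypersurface {N : ℕ} (g : Fin N → Δ.grading 1) : Prop :=
  ∀ x : ProjectiveSpectrum (quotientGrading Δ.grading (f : Δ.polytopeAlgebra)), ∃ i,
    quotientGradedHom Δ.grading (f : Δ.polytopeAlgebra) (g i : Δ.polytopeAlgebra) ∉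
      x.asHomogeneousIdeal

theorem exists_coversHypersurface :
    ∃ g : Fin Δ.points.card → Δ.grading 1, Δ.CoversHypersurface f g := by
  refine ⟨fun i => Δ.vertexMonomial (Δ.points.equivFin.symm i), fun x => ?_⟩
  by_contra! h
  refine x.not_irrelevant_le ((HomogeneousIdeal.irrelevant_le _).2 ?_)
  rintro i hi _ ⟨a, ha, rfl⟩
  refine Δ.mem_of_forall_vertexMonomial_mem (𝔭 := x.asHomogeneousIdeal.toIdeal.comap
    (quotientGradedHom Δ.grading (f : Δ.polytopeAlgebra)).toRingHom)
    (Ideal.comap_isPrime _ _) (fun v => ?_) hi ha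
  have := h (Δ.points.equivFin v)
  rwa [Equiv.symm_apply_apply] at this

variable {f}

/-- The `g i` map Y to projective space of dimension N ≥ n, and the image lies in a hypersurface.
Projection from a point off it stays defined on the image, so the new linear combinations have no
common zero on Y. -/
theorem CoversHypersurface.exists_succ (hf : f ≠ 0) {N : ℕ} (hN : n ≤ N)
    {g : Fin (N + 1) → Δ.grading 1} (hg : Δ.CoversHypersurface f g) :
    ∃ g' : Fin N → Δ.grading 1, Δ.CoversHypersurface f g' := by
  obtain ⟨R, hR, hd⟩ := exists_dvd_aeval_of_trdeg_le (N := N)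
    -- `n ≤ N` enters here: the transcendence degree is at most n + 1 ≤ N + 1.
    (Δ.trdeg_polytopeAlgebra_le.trans (Nat.cast_le.2 (by omega)))
    (f := (f : Δ.polytopeAlgebra)) (by simpa using hf) (fun i => (g i : Δ.polytopeAlgebra))
  let π := Ideal.Quotient.mkₐ ℂ (Ideal.span {(f : Δ.polytopeAlgebra)})
  have h0 : MvPolynomial.aeval (fun i => π (g i)) R = 0 := by
    have : π (MvPolynomial.aeval (fun i => (g i : Δ.polytopeAlgebra)) R) = 0 :=
      Ideal.Quotient.eq_zero_iff_mem.2 (Ideal.mem_span_singleton.2 hd)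
    rwa [← AlgHom.comp_apply, MvPolynomial.comp_aeval] at this
  obtain ⟨d, Q, hQ, hQd, hQ0⟩ := exists_isHomogeneous_aeval_eq_zero
    (quotientGrading Δ.grading (f : Δ.polytopeAlgebra))
    (fun i => mk_mem_quotientGrading Δ.grading (f : Δ.polytopeAlgebra) (g i).2) hR h0
  obtain ⟨t, ht⟩ := exists_forall_mem_of_isHomogeneous hQ hQd hQ0
  refine ⟨fun i => g i.succ - t i • g 0, fun x => ?_⟩
  by_contra! h
  obtain ⟨i, hi⟩ := hg x
  exact hi (ht _ x.isPrime h i)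

/-- A hypersurface in the toric variety of a polytope of dimension `n` is covered by at most `n`
of the open sets where a section of degree one does not vanish. -/
theorem exists_le_coversHypersurface (hf : f ≠ 0) :
    ∃ (N : ℕ) (_ : N ≤ n) (g : Fin N → Δ.grading 1), Δ.CoversHypersurface f g := by
  rcases le_total Δ.points.card n with h | h
  · exact ⟨_, h, Δ.exists_coversHypersurface f⟩
  · refine ⟨n, le_rfl, ?_⟩
    refine Nat.decreasingInduction' (P := fun N => ∃ g : Fin N → Δ.grading 1,
      Δ.CoversHypersurface f g) (fun N _ hN ⟨g, hg⟩ => hg.exists_succ Δ hf hN) h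
      (Δ.exists_coversHypersurface f)

end LatticePolytope
end ToricCover

/-! ### Assembling the vanishing theorem -/

section Vanishing
variable {X : Scheme.{u}}

theorem subsingleton_cohomology_of_iso {E E' : X.Modules} (i : E ≅ E') (q : ℤ)
    [Subsingleton (cohomology q E')] : Subsingleton (cohomology q E) := by
  let j : (SheafOfModules.toSheaf X.ringCatSheaf).obj E ≅
      (SheafOfModules.toSheaf X.ringCatSheaf).obj E' :=
    (SheafOfModules.toSheaf X.ringCatSheaf).mapIso i
  have e : cohomology q E ≃ cohomology q E' := Iso.homToEquiv ((shiftFunctor _ q).mapIso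
    ((DerivedCategory.singleFunctor _ 0).mapIso j))
  exact e.subsingleton

/-- Exactness of ℋom(A, -) reduces the derived Hom to the cohomology sheaves of `F`. -/
theorem nonempty_extSheaf_iso (A : X.Modules) (hA : ∀ x : X, ∃ U : X.Opens, x ∈ U ∧ IsFreeOn A U)
    (F : DerivedCategory.Plus X.Modules) (p : ℤ) : Nonempty (extSheaf p A F ≅
      sheafHomObj A ((DerivedCategory.Plus.homologyFunctor X.Modules p).obj F)) := by
  have := preservesHomology_sheafHom A hA
  exact nonempty_homology_rightDerivedFunctorPlus_iso (sheafHom A) F p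

/-- If a separated scheme has a cover by `N` affine open sets over which `A` is free of rank one,
then the cohomology of `ℋom(A, M)`, `M` quasi-coherent, vanishes in degrees `≥ N`. -/
theorem subsingleton_cohomology_sheafHomObj [X.IsSeparated] (A M : X.Modules) [M.IsQuasicoherent]
    {N : ℕ} (U : Fin N → X.Opens) (hU : ∀ i, IsAffineOpen (U i)) (hA : ∀ i, IsFreeOn A (U i))
    (hcov : ∀ x : X, ∃ i, x ∈ U i) {q : ℕ} (hq : N ≤ q) :
    Subsingleton (cohomology (q : ℤ) (sheafHomObj A M)) := by
  have : HasExt.{u + 1} (Sheaf (Opens.grothendieckTopology X) AddCommGrpCat.{u}) :=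
    hasExt_of_hasDerivedCategory _
  apply subsingleton_cohomology_of_H'
  have htop : (List.ofFn U).foldr (· ⊔ ·) ⊥ = ⊤ := by
    refine top_le_iff.1 fun x _ => ?_
    obtain ⟨i, hi⟩ := hcov x
    have hle : ∀ l : List X.Opens, U i ∈ l → U i ≤ l.foldr (· ⊔ ·) ⊥ := by
      intro l hl
      induction l with
      | nil => simp at hl
      | cons V l ih =>
        rcases List.mem_cons.1 hl with h | h
        · rw [h]
          exact le_sup_left
        · exact (ih h).trans le_sup_right
    exact hle _ (List.mem_ofFn.2 ⟨i, rfl⟩) hi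
  rw [← htop]
  -- Separatedness keeps affine open sets stable under intersection; freeness passes to smaller open
  -- sets.
  refine subsingleton_H'_foldr _ (fun V : X.Opens => IsAffineOpen V ∧ IsFreeOn A V)
    (fun V W hV hW => ⟨hV.1.inf hW.1, hV.2.mono inf_le_left⟩)
    (fun V hV q => subsingleton_H'_of_isAffineOpen hV.1 (ExtendsFromBasicOpens.sheafHom M hV.2
      (extendsFromBasicOpens_of_isQuasicoherent M hV.1)) q) (List.ofFn U) ?_ q
    (by rwa [List.length_ofFn])
  intro V hV
  obtain ⟨i, rfl⟩ := List.mem_ofFn.1 hV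
  exact ⟨hU i, hA i⟩

theorem isQuasicoherent_of_isCoherent {M : X.Modules} (hM : IsCoherent M) : M.IsQuasicoherent := by
  obtain ⟨σ, -⟩ := SheafOfModules.IsFinitePresentation.exists_quasicoherentData (self := hM)
  exact SheafOfModules.QuasicoherentData.isQuasicoherent (R := X.ringCatSheaf) (M := M) σ

end Vanishing

theorem LatticePolytope.isFreeOn_lineBundle {n : ℕ} (Δ : LatticePolytope n) (f g : Δ.grading 1) :
    IsFreeOn (Δ.lineBundle f)
      (Δ.hypersurfaceι f ⁻¹ᵁ Proj.basicOpen Δ.grading (g : Δ.polytopeAlgebra)) :=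
  (isFreeOn_twist g.2 _).pullback _

/-- This preimage is by definition the principal open set of the class of `g`, which has positive
degree. -/
theorem LatticePolytope.isAffineOpen_preimage_basicOpen {n : ℕ} (Δ : LatticePolytope n)
    (f g : Δ.grading 1) : IsAffineOpen
      (Δ.hypersurfaceι f ⁻¹ᵁ Proj.basicOpen Δ.grading (g : Δ.polytopeAlgebra)) :=
  Proj.isAffineOpen_basicOpen (quotientGrading Δ.grading (f : Δ.polytopeAlgebra)) _
    (mk_mem_quotientGrading Δ.grading (f : Δ.polytopeAlgebra) g.2) one_pos

end
end BraneVertex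

theorem theorem4p2 {n : ℕ} (Δ : BraneVertex.LatticePolytope n) (hΔ : Δ.IsReflexive)
    (f : Δ.grading 1) (hf : f ≠ 0) (r s : ℤ) (F : BraneVertex.Db (Δ.hypersurface f))
    (hs : F.obj.IsLE s) (hr : F.obj.IsGE r) (b p q : ℤ)
    (h : Nontrivial (BraneVertex.cohomology q
      (BraneVertex.extSheaf p (BraneVertex.tensorZPow (Δ.lineBundle f) b) F.obj))) :
    (p, q) ∈ Set.Icc r s ×ˢ Set.Icc 0 ((n : ℤ) - 1) := by
  obtain ⟨N, hN, g, hg⟩ := Δ.exists_le_coversHypersurface hf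
  let U : Fin N → (Δ.hypersurface f).Opens := fun i =>
    Δ.hypersurfaceι f ⁻¹ᵁ Proj.basicOpen Δ.grading (g i : Δ.polytopeAlgebra)
  have hcov : ∀ x : Δ.hypersurface f, ∃ i, x ∈ U i := hg
  have hfree : ∀ i, BraneVertex.IsFreeOn (BraneVertex.tensorZPow (Δ.lineBundle f) b) (U i) :=
    fun i => (Δ.isFreeOn_lineBundle f (g i)).tensorZPow b
  have : (Δ.hypersurface f).IsSeparated :=
    inferInstanceAs (Proj (BraneVertex.quotientGrading Δ.grading
      (f : Δ.polytopeAlgebra))).IsSeparated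
  obtain ⟨i⟩ := BraneVertex.nonempty_extSheaf_iso (BraneVertex.tensorZPow (Δ.lineBundle f) b)
    (fun x => (hcov x).imp' U fun i hi => ⟨hi, hfree i⟩) F.obj p
  -- This gives both bounds on `p`, since H^p(F) vanishes outside [r, s].
  have hzero : ¬ IsZero ((DerivedCategory.Plus.homologyFunctor _ p).obj F.obj) := fun h0 =>
    not_subsingleton_iff_nontrivial.2 h (BraneVertex.subsingleton_cohomology_of_isZero _
      (IsZero.of_iso (Functor.map_isZero (BraneVertex.sheafHom _) h0) i) q)
  have := BraneVertex.isQuasicoherent_of_isCoherent (F.property.2 p)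
  refine ⟨⟨?_, ?_⟩, ?_, ?_⟩
  · by_contra! hp
    exact hzero (F.obj.isZero_homology_of_isGE r p hp)
  · by_contra! hp
    exact hzero (F.obj.isZero_homology_of_isLE s p hp)
  · by_contra! hq
    exact not_subsingleton_iff_nontrivial.2 h (BraneVertex.subsingleton_cohomology_of_neg _ hq)
  · by_contra! hq
    dsimp only at hq
    -- Here q > n - 1, so q ≥ n ≥ N, the size of the affine cover.
    obtain ⟨m, rfl⟩ := Int.eq_ofNat_of_zero_le (show 0 ≤ q by omega)
    have := BraneVertex.subsingleton_cohomology_sheafHomObj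
      (BraneVertex.tensorZPow (Δ.lineBundle f) b)
      ((DerivedCategory.Plus.homologyFunctor _ p).obj F.obj) U
      (fun i => Δ.isAffineOpen_preimage_basicOpen f (g i)) hfree hcov (q := m)
      (by omega)
    exact not_subsingleton_iff_nontrivial.2 h (BraneVertex.subsingleton_cohomology_of_iso i _)
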